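/- \textbf{Theorem (Base-Aligned).} A \emph{simple rectilinear polygon} is a closed polygonal curve in $\mathbb{R}^2$ given by a finite cyclic sequence of non-degenerate edges that are alternately horizontal and vertical, such that non-adjacent edges are disjoint. Its \emph{closed region} is the union of its edges and of the bounded open region that they enclose. A \emph{rectilinear polygon} $P=(E,\mathcal H)$ consists of a simple rectilinear polygon $E$ and a finite (possibly empty) set $\mathcal H$ of simple rectilinear polygons, the holes, such that the closed region of each hole is a proper subset of the closed region of $E$, and the closed regions of any two distinct holes are disjoint or meet in exactly one point, which is a vertex of both. Let $\mathcal I(P)$ be the closure of the set obtained from the open region enclosed by $E$ by removing the closed regions of all holes. (If no hole shares a boundary segment with $E$, this is the closed region of $E$ minus the open regions enclosed by the holes.) A vertex $v$ of $E$ or of a hole is \emph{concave} if the interior angle of $P$ at $v$ is $3\pi/2$, i.e. near $v$ the set $\mathcal I(P)$ is the complement of one open axis-parallel quadrant with apex $v$. From each concave vertex shoot one horizontal and one vertical ray through the interior of $\mathcal I(P)$ until it meets the boundary. These rays cut the interior of $\mathcal I(P)$ into connected components; the closed rectangles whose open parts are these components are the \emph{base rectangles}, and $\mathcal B(P)$ is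 the set of them. A \emph{rectangle} is a set $[a,b]\times[c,d]$ with $a<b$ and $c<d$. For a set $\mathcal R$ of rectangles, $\Gamma(\mathcal R)$ is the set of all rectangles that are unions of members of $\mathcal R$. A \emph{cover} of $P$ is a finite set $\mathcal C$ of rectangles contained in $\mathcal I(P)$ with $\bigcup_{R\in\mathcal C}R=\mathcal I(P)$. For reals $\alpha,\beta\ge 0$ its cost is $\sum_{R\in\mathcal C}\bigl(\alpha+\beta\cdot\mathrm{area}(R)\bigr)$, and it is \emph{optimal} if no cover of $P$ has smaller cost. Then for every rectilinear polygon $P$ and all reals $\alpha,\beta\ge 0$ there exists an optimal cover $\mathcal C$ of $P$ with $\mathcal C\subseteq\Gamma(\mathcal B(P))$. -/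

import Mathlib

open Set Filter Topology

noncomputable section

namespace RectCover

/-- A hole-free, non-self-intersecting rectilinear polygon, given by its cyclic sequence of
vertices `vert 0, …, vert (size - 1)`; the edge with index `i` joins `vert i` to `vert (i + 1)`
(indices modulo `size`). Horizontal and vertical edges alternate, and edges that are not adjacent
are disjoint. -/
structure SimplePolygon where
  size : ℕ
  size_pos : 0 < size
  vert : ZMod size → ℝ × ℝ
  nondegenerate : ∀ i, vert i ≠ vert (i + 1)
  alternating : ∀ i,
    ((vert i).2 = (vert (i + 1)).2 ∧ (vert (i + 1)).1 = (vert (i + 1 + 1)).1) ∨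
    ((vert i).1 = (vert (i + 1)).1 ∧ (vert (i + 1)).2 = (vert (i + 1 + 1)).2)
  simple : ∀ i j, i ≠ j → j ≠ i + 1 → i ≠ j + 1 →
    Disjoint (segment ℝ (vert i) (vert (i + 1))) (segment ℝ (vert j) (vert (j + 1)))

namespace SimplePolygon

variable (H : SimplePolygon)

/-- The union of all edges. -/
def boundary : Set (ℝ × ℝ) := ⋃ i, segment ℝ (H.vert i) (H.vert (i + 1))

/-- The open region enclosed by the edges: the points off the boundary curve whose connected
component in the complement of the curve is bounded. -/
def enclosed : Set (ℝ × ℝ) :=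
  {p | p ∉ H.boundary ∧ Bornology.IsBounded (connectedComponentIn H.boundaryᶜ p)}

/-- The closed region bounded by the edges. -/
def closedRegion : Set (ℝ × ℝ) := H.boundary ∪ H.enclosed

end SimplePolygon

/-- A rectilinear polygon with (finitely many, possibly no) holes. Every hole is strictly contained
in the region of the outer polygon, and two holes may meet in at most one point, which is then a
vertex of both of them. -/
structure Polygon where
  outer : SimplePolygon
  holes : Finset SimplePolygon
  holes_contained : ∀ H ∈ holes, H.closedRegion ⊂ outer.closedRegion
  holes_meet : ∀ H ∈ holes, ∀ H' ∈ holes, H ≠ H' →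
    (H.closedRegion ∩ H'.closedRegion).Subsingleton ∧
    H.closedRegion ∩ H'.closedRegion ⊆ range H.vert ∩ range H'.vert

namespace Polygon

variable (P : Polygon)

/-- All vertices, of the outer polygon and of the holes. -/
def vertices : Set (ℝ × ℝ) := range P.outer.vert ∪ ⋃ H ∈ P.holes, range H.vert

/-- The closed region `I(P)`: the closure of what remains of the region enclosed by the outer
polygon after the holes are removed. Whenever the holes share no boundary segment with the outer
polygon this is the closed region of the outer polygon minus the open regions enclosed by the
holes; if segments are shared, taking the closure drops them. -/
def region : Set (ℝ × ℝ) := closure (P.outer.enclosed \ ⋃ H ∈ P.holes, H.closedRegion)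

/-- A vertex is concave if the interior angle is `3π/2`: near `v` the region is the complement of
one open quadrant at `v`. (At a common vertex of two holes all four axis directions are occupied by
edges, so no ray can be shot from it into the interior.) -/
def IsConcaveVertex (v : ℝ × ℝ) : Prop :=
  v ∈ P.vertices ∧ ∃ s t : ℝ, (s = 1 ∨ s = -1) ∧ (t = 1 ∨ t = -1) ∧
    ∀ᶠ p in 𝓝 v, p ∈ P.region ↔ ¬ (0 < s * (p.1 - v.1) ∧ 0 < t * (p.2 - v.2))

/-- The union of all horizontal and vertical rays shot from concave vertices through the interior
of the region, up to (and excluding) the point where they meet the boundary. Of the four axis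
directions at a concave vertex, exactly one horizontal and one vertical one enter the interior. -/
def rays : Set (ℝ × ℝ) :=
  {q | ∃ v, P.IsConcaveVertex v ∧ q ≠ v ∧ (q.1 = v.1 ∨ q.2 = v.2) ∧
    ∀ z ∈ segment ℝ v q, z ≠ v → z ∈ interior P.region}

end Polygon

/-- A non-degenerate axis-aligned rectangle `[left, right] × [bottom, top]`. -/
@[ext]
structure Rect where
  left : ℝ
  right : ℝ
  bottom : ℝ
  top : ℝ
  left_lt_right : left < right
  bottom_lt_top : bottom < top

namespace Rect

variable (R : Rect)

/-- The closed rectangle as a set of points. -/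
def toSet : Set (ℝ × ℝ) := Icc R.left R.right ×ˢ Icc R.bottom R.top

/-- The open rectangle. -/
def openSet : Set (ℝ × ℝ) := Ioo R.left R.right ×ˢ Ioo R.bottom R.top

def area : ℝ := (R.right - R.left) * (R.top - R.bottom)

end Rect

/-- The base rectangles of `P`: the rectangles whose open part is one of the connected components
into which the rays cut the interior of the region. -/
def baseRects (P : Polygon) : Set Rect :=
  {R | ∃ p ∈ interior P.region \ P.rays,
    connectedComponentIn (interior P.region \ P.rays) p = R.openSet}

/-- The rectangle powerset `Γ(𝓡)`: all rectangles that are unions of members of `𝓡`. -/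
def rectPowerset (𝓡 : Set Rect) : Set Rect :=
  {R | ∃ S ⊆ 𝓡, R.toSet = ⋃ Q ∈ S, Q.toSet}

/-- A finite set of rectangles contained in the region of `P` whose union is that region. -/
def IsCover (P : Polygon) (C : Finset Rect) : Prop :=
  (∀ R ∈ C, R.toSet ⊆ P.region) ∧ P.region = ⋃ R ∈ C, R.toSet

/-- The cost `∑ (α + β · area)` of a set of rectangles. -/
def cost (α β : ℝ) (C : Finset Rect) : ℝ := ∑ R ∈ C, (α + β * R.area)

/-- A cover of minimum cost. -/
def IsOptimalCover (P : Polygon) (α β : ℝ) (C : Finset Rect) : Prop :=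
  IsCover P C ∧ ∀ C' : Finset Rect, IsCover P C' → cost α β C ≤ cost α β C'

end RectCover

end

open Set Filter Topology

noncomputable section

namespace RectCover

/-! ### Topology of the line and the plane -/

/-! The region is a finite union of rectangles (`exists_region_eq_unionOf`) and its concave corners
are all vertices (`isConcaveVertex_iff`). Given these two facts, the argument is about finite unions
of rectangles and the rays from their concave corners.

Cut the interior along the vertical rays only. If neither end of a maximal vertical segment in the
interior is a concave corner, the region looks like a half-plane at both ends, so nearby segments
have the same ends (`Free.eventually`). Hence the pieces of the cut are open rectangles, the strips
(`exists_strip`, `IsStrip.subset_openSet`).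

Given a cover, move every vertical side that lies inside a strip to an end of that strip: to the
left end if its relative position is less than a threshold `t`, to the right end otherwise, with one
`t` in (0,1) for all sides. For every `t` the result is again a cover: the old rectangles cover the
threshold line of each strip, and those crossing it get stretched over the full width
(`unionOf_snapRect`). For uniformly random `t` the mean position of a side is its old position
(`integral_snap`). Heights are fixed and area is linear in the positions of the vertical sides, so
the mean cost does not rise, and some `t` does at least as well as the mean (`exists_threshold`).

The ends of a strip lie on rays or on the boundary, so the vertical sides are now aligned. The same
pass with the coordinates exchanged aligns the horizontal sides and keeps the vertical ones aligned
(`exists_aligned_cover`). A rectangle with aligned sides is a union of base rectangles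
(`mem_rectPowerset_of_aligned`). There are finitely many covers by such unions, and a cheapest one
is optimal. -/

theorem eventually_nhds_prod_iff_abs {v : ℝ × ℝ} {φ : ℝ × ℝ → Prop} :
    (∀ᶠ p in 𝓝 v, φ p) ↔
      ∃ ε > 0, ∀ x y, |x - v.1| < ε → |y - v.2| < ε → φ (x, y) := by
  simp only [Metric.eventually_nhds_iff, Prod.forall, Prod.dist_eq, Real.dist_eq, max_lt_iff,
    and_imp]

theorem mem_interior_iff_abs {I : Set (ℝ × ℝ)} {v : ℝ × ℝ} :
    v ∈ interior I ↔ ∃ ε > 0, ∀ x y, |x - v.1| < ε → |y - v.2| < ε → (x, y) ∈ I := by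
  rw [mem_interior_iff_mem_nhds]
  exact eventually_nhds_prod_iff_abs

/-- A point of an open set of reals lies in a maximal open interval contained in the set, provided
that the set contains neither all smaller nor all larger reals. -/
theorem exists_maximal_Ioo {U : Set ℝ} (hU : IsOpen U) {x : ℝ} (hx : x ∈ U)
    (hl : ∃ y ≤ x, y ∉ U) (hr : ∃ y, x ≤ y ∧ y ∉ U) :
    ∃ a b, a < x ∧ x < b ∧ Ioo a b ⊆ U ∧ a ∉ U ∧ b ∉ U := by
  obtain ⟨y, hyx, hy⟩ := hl
  obtain ⟨z, hxz, hz⟩ := hr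
  have hc : IsClosed (Uᶜ ∩ Iic x) := hU.isClosed_compl.inter isClosed_Iic
  have hd : IsClosed (Uᶜ ∩ Ici x) := hU.isClosed_compl.inter isClosed_Ici
  have hcb : BddAbove (Uᶜ ∩ Iic x) := ⟨x, fun w hw => hw.2⟩
  have hdb : BddBelow (Uᶜ ∩ Ici x) := ⟨x, fun w hw => hw.2⟩
  have ha := hc.csSup_mem ⟨y, hy, hyx⟩ hcb
  have hb := hd.csInf_mem ⟨z, hz, hxz⟩ hdb
  refine ⟨_, _, lt_of_le_of_ne ha.2 fun h => ha.1 (by rwa [h]),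
    lt_of_le_of_ne hb.2 fun h => hb.1 (by rwa [← h]), fun w hw => ?_, ha.1, hb.1⟩
  by_contra hwU
  rcases le_total w x with h | h
  · exact absurd (le_csSup hcb ⟨hwU, h⟩) (not_le.2 hw.1)
  · exact absurd (csInf_le hdb ⟨hwU, h⟩) (not_le.2 hw.2)

theorem interior_swap_preimage (I : Set (ℝ × ℝ)) :
    interior (Prod.swap ⁻¹' I) = Prod.swap ⁻¹' interior I :=
  ((Homeomorph.prodComm ℝ ℝ).preimage_interior I).symm

/-! ### Rectangles -/

namespace Rect

variable (R : Rect)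

/-- The reflection of a rectangle in the diagonal. -/
@[simps]
def swap : Rect := ⟨R.bottom, R.top, R.left, R.right, R.bottom_lt_top, R.left_lt_right⟩

theorem swap_swap : R.swap.swap = R := rfl

theorem area_swap : R.swap.area = R.area := mul_comm _ _

theorem area_pos : 0 < R.area :=
  mul_pos (sub_pos.2 R.left_lt_right) (sub_pos.2 R.bottom_lt_top)

theorem mem_toSet {p : ℝ × ℝ} :
    p ∈ R.toSet ↔ (R.left ≤ p.1 ∧ p.1 ≤ R.right) ∧ R.bottom ≤ p.2 ∧ p.2 ≤ R.top := Iff.rfl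

theorem mem_openSet {p : ℝ × ℝ} :
    p ∈ R.openSet ↔ (R.left < p.1 ∧ p.1 < R.right) ∧ R.bottom < p.2 ∧ p.2 < R.top := Iff.rfl

theorem toSet_swap : R.swap.toSet = Prod.swap ⁻¹' R.toSet := by
  ext p
  simp only [mem_toSet, mem_preimage, swap_left, swap_right, swap_bottom, swap_top, Prod.fst_swap,
    Prod.snd_swap]
  tauto

theorem isClosed_toSet : IsClosed R.toSet := isClosed_Icc.prod isClosed_Icc

theorem isCompact_toSet : IsCompact R.toSet := isCompact_Icc.prod isCompact_Icc

theorem isOpen_openSet : IsOpen R.openSet := isOpen_Ioo.prod isOpen_Ioo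

theorem isPreconnected_openSet : IsPreconnected R.openSet :=
  isPreconnected_Ioo.prod isPreconnected_Ioo

theorem closure_openSet : closure R.openSet = R.toSet := by
  rw [openSet, closure_prod_eq, closure_Ioo R.left_lt_right.ne, closure_Ioo R.bottom_lt_top.ne,
    toSet]

theorem openSet_subset_toSet : R.openSet ⊆ R.toSet :=
  prod_mono Ioo_subset_Icc_self Ioo_subset_Icc_self

theorem openSet_subset_interior {I : Set (ℝ × ℝ)} (h : R.toSet ⊆ I) : R.openSet ⊆ interior I :=
  interior_maximal (R.openSet_subset_toSet.trans h) R.isOpen_openSet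

theorem toSet_injective : Function.Injective toSet := by
  intro R Q h
  have h1 := R.left_lt_right
  have h2 := R.bottom_lt_top
  have h3 := Q.left_lt_right
  have h4 := Q.bottom_lt_top
  have a1 : (R.left, R.bottom) ∈ Q.toSet := h ▸ ⟨⟨le_rfl, h1.le⟩, le_rfl, h2.le⟩
  have a2 : (R.right, R.top) ∈ Q.toSet := h ▸ ⟨⟨h1.le, le_rfl⟩, h2.le, le_rfl⟩
  have a3 : (Q.left, Q.bottom) ∈ R.toSet := h ▸ ⟨⟨le_rfl, h3.le⟩, le_rfl, h4.le⟩
  have a4 : (Q.right, Q.top) ∈ R.toSet := h ▸ ⟨⟨h3.le, le_rfl⟩, h4.le, le_rfl⟩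
  simp only [mem_toSet] at a1 a2 a3 a4
  ext <;> apply le_antisymm <;> tauto

theorem openSet_injective : Function.Injective openSet := fun R Q h =>
  toSet_injective (by rw [← closure_openSet, h, closure_openSet])

/-- The rectangles with all coordinates in given finite sets form a finite set. -/
theorem finite_of_coords {X Y : Set ℝ} (hX : X.Finite) (hY : Y.Finite) :
    {R : Rect | R.left ∈ X ∧ R.right ∈ X ∧ R.bottom ∈ Y ∧ R.top ∈ Y}.Finite := by
  refine Finite.of_finite_image (f := fun R : Rect => ((R.left, R.right), (R.bottom, R.top)))
    (((hX.prod hX).prod (hY.prod hY)).subset ?_) ?_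
  · rintro _ ⟨R, ⟨h1, h2, h3, h4⟩, rfl⟩
    exact ⟨⟨h1, h2⟩, h3, h4⟩
  · intro R _ Q _ h
    simp only [Prod.mk.injEq] at h
    ext <;> tauto

end Rect

/-! ### Finite unions of rectangles -/

/-- The union of a finite set of rectangles. -/
def unionOf (F : Finset Rect) : Set (ℝ × ℝ) := ⋃ R ∈ F, R.toSet

/-- The abscissae of the sides of the rectangles of `F`. -/
def xCoords (F : Finset Rect) : Set ℝ := {x | ∃ R ∈ F, x = R.left ∨ x = R.right}

/-- The set of reflections of the rectangles of `F`. -/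
def swapAll (F : Finset Rect) : Finset Rect :=
  F.map ⟨Rect.swap, fun R Q h => by rw [← R.swap_swap, h, Q.swap_swap]⟩

/-- The ordinates of the sides of the rectangles of `F`. -/
def yCoords (F : Finset Rect) : Set ℝ := xCoords (swapAll F)

theorem mem_swapAll {F : Finset Rect} {R : Rect} : R ∈ swapAll F ↔ R.swap ∈ F := by
  simp only [swapAll, Finset.mem_map]
  exact ⟨fun ⟨Q, hQ, h⟩ => h ▸ hQ, fun h => ⟨_, h, R.swap_swap⟩⟩

theorem swapAll_swapAll (F : Finset Rect) : swapAll (swapAll F) = F := by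
  ext R
  simp only [mem_swapAll, Rect.swap_swap]

theorem cost_swapAll (α β : ℝ) (F : Finset Rect) : cost α β (swapAll F) = cost α β F := by
  rw [cost, swapAll, Finset.sum_map]
  exact Finset.sum_congr rfl fun R _ => by rw [← R.area_swap]; rfl

theorem mem_yCoords {F : Finset Rect} {y : ℝ} :
    y ∈ yCoords F ↔ ∃ R ∈ F, y = R.bottom ∨ y = R.top := by
  simp only [yCoords, xCoords, mem_swapAll, mem_ofPred_eq]
  exact ⟨fun ⟨R, hR, h⟩ => ⟨R.swap, hR, h⟩, fun ⟨R, hR, h⟩ => ⟨R.swap, hR, h⟩⟩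

theorem mem_unionOf {F : Finset Rect} {p : ℝ × ℝ} : p ∈ unionOf F ↔ ∃ R ∈ F, p ∈ R.toSet := by
  simp [unionOf]

theorem unionOf_swapAll (F : Finset Rect) : unionOf (swapAll F) = Prod.swap ⁻¹' unionOf F := by
  ext p
  simp only [mem_preimage, mem_unionOf, mem_swapAll]
  constructor
  · rintro ⟨R, hR, hp⟩
    exact ⟨_, hR, by rwa [Rect.toSet_swap, mem_preimage, Prod.swap_swap]⟩
  · rintro ⟨R, hR, hp⟩
    exact ⟨R.swap, hR, by rwa [Rect.toSet_swap, mem_preimage]⟩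

theorem toSet_subset_unionOf {F : Finset Rect} {R : Rect} (h : R ∈ F) : R.toSet ⊆ unionOf F :=
  fun _ hp => mem_unionOf.2 ⟨R, h, hp⟩

theorem isCompact_unionOf (F : Finset Rect) : IsCompact (unionOf F) :=
  F.finite_toSet.isCompact_biUnion fun R _ => R.isCompact_toSet

theorem finite_xCoords (F : Finset Rect) : (xCoords F).Finite := by
  refine ((F.finite_toSet.image Rect.left).union (F.finite_toSet.image Rect.right)).subset ?_
  rintro x ⟨R, hR, rfl | rfl⟩
  · exact Or.inl ⟨R, hR, rfl⟩
  · exact Or.inr ⟨R, hR, rfl⟩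

theorem finite_yCoords (F : Finset Rect) : (yCoords F).Finite := finite_xCoords _

theorem dense_compl_prod_compl {X Y : Set ℝ} (hX : X.Finite) (hY : Y.Finite) :
    Dense (Xᶜ ×ˢ Yᶜ) :=
  (hX.countable.dense_compl ℝ).prod (hY.countable.dense_compl ℝ)

/-- Coverage and containment into closed sets need only be checked at interior points off finitely
many coordinate lines, in particular off all rays. -/
theorem unionOf_subset_closure (F : Finset Rect) {X Y : Set ℝ} (hX : X.Finite) (hY : Y.Finite) :
    unionOf F ⊆ closure (interior (unionOf F) ∩ Xᶜ ×ˢ Yᶜ) := by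
  intro p hp
  obtain ⟨R, hR, hpR⟩ := mem_unionOf.1 hp
  rw [← R.closure_openSet] at hpR
  have h1 := (dense_compl_prod_compl hX hY).open_subset_closure_inter R.isOpen_openSet
  exact closure_mono (inter_subset_inter_left _
    (R.openSet_subset_interior (toSet_subset_unionOf hR))) (closure_minimal h1 isClosed_closure hpR)

/-! ### Local structure -/

/-- `P` and `N` record whether the interval extends from `x` to the right and to the left; both fail
when `x` lies outside it. -/
theorem Icc_local {l r : ℝ} (h : l < r) (x : ℝ) :
    ∃ P N : Prop, ∀ᶠ u in 𝓝 x, u ∈ Icc l r ↔ (P ∧ x ≤ u) ∨ (N ∧ u ≤ x) := by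
  refine ⟨l ≤ x ∧ x < r, l < x ∧ x ≤ r, ?_⟩
  have e1 : ∀ᶠ u in 𝓝 x, (l < x → l < u) ∧ (x < l → u < l) :=
    (eventually_imp_distrib_left.2 fun h => lt_mem_nhds h).and
      (eventually_imp_distrib_left.2 fun h => gt_mem_nhds h)
  have e2 : ∀ᶠ u in 𝓝 x, (r < x → r < u) ∧ (x < r → u < r) :=
    (eventually_imp_distrib_left.2 fun h => lt_mem_nhds h).and
      (eventually_imp_distrib_left.2 fun h => gt_mem_nhds h)
  filter_upwards [e1, e2] with u h1 h2
  simp only [mem_Icc]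
  grind

/-- Near every point a finite union of rectangles is a union of some of the four closed
quadrants at the point. -/
theorem unionOf_local (F : Finset Rect) (v : ℝ × ℝ) :
    ∃ A B C D : Prop, ∃ ε > 0, ∀ x y, |x - v.1| < ε → |y - v.2| < ε →
      ((x, y) ∈ unionOf F ↔ (A ∧ v.1 ≤ x ∧ v.2 ≤ y) ∨ (B ∧ x ≤ v.1 ∧ v.2 ≤ y) ∨
        (C ∧ x ≤ v.1 ∧ y ≤ v.2) ∨ (D ∧ v.1 ≤ x ∧ y ≤ v.2)) := by
  choose P N h using fun R : Rect => Icc_local R.left_lt_right v.1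
  choose P' N' h' using fun R : Rect => Icc_local R.bottom_lt_top v.2
  -- A quadrant is present when a single rectangle extends from `v` in both of its directions.
  refine ⟨∃ R ∈ F, P R ∧ P' R, ∃ R ∈ F, N R ∧ P' R, ∃ R ∈ F, N R ∧ N' R, ∃ R ∈ F, P R ∧ N' R, ?_⟩
  have key : ∀ᶠ p in 𝓝 v, ∀ R ∈ F, (p.1 ∈ Icc R.left R.right ↔ (P R ∧ v.1 ≤ p.1) ∨
      (N R ∧ p.1 ≤ v.1)) ∧ (p.2 ∈ Icc R.bottom R.top ↔ (P' R ∧ v.2 ≤ p.2) ∨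
      (N' R ∧ p.2 ≤ v.2)) := by
    rw [eventually_all_finset]
    exact fun R _ => (continuous_fst.continuousAt.eventually (h R)).and
      (continuous_snd.continuousAt.eventually (h' R))
  obtain ⟨ε, hε, H⟩ := eventually_nhds_prod_iff_abs.1 key
  refine ⟨ε, hε, fun x y hx hy => ?_⟩
  have H := H x y hx hy
  rw [mem_unionOf]
  constructor
  · rintro ⟨R, hR, hp⟩
    have h1 := (H R hR).1.1 hp.1
    have h2 := (H R hR).2.1 hp.2
    grind
  · have : (∃ R ∈ F, ((P R ∧ v.1 ≤ x) ∨ (N R ∧ x ≤ v.1)) ∧ ((P' R ∧ v.2 ≤ y) ∨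
        (N' R ∧ y ≤ v.2))) → ∃ R ∈ F, (x, y) ∈ R.toSet :=
      fun ⟨R, hR, h1, h2⟩ => ⟨R, hR, (H R hR).1.2 h1, (H R hR).2.2 h2⟩
    grind

/-- Off the abscissae of the sides, a finite union of rectangles is locally constant in the
horizontal direction. -/
theorem exists_gap {F : Finset Rect} {x : ℝ} (hx : x ∉ xCoords F) :
    ∃ ε > 0, ∀ x', |x' - x| < ε → ∀ y, ((x', y) ∈ unionOf F ↔ (x, y) ∈ unionOf F) ∧
      ((x', y) ∈ interior (unionOf F) ↔ (x, y) ∈ interior (unionOf F)) := by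
  have key : ∀ᶠ x' in 𝓝 x, ∀ R ∈ F, x' ∈ Icc R.left R.right ↔ x ∈ Icc R.left R.right := by
    rw [eventually_all_finset]
    intro R hR
    have hl : x ≠ R.left := fun h => hx ⟨R, hR, Or.inl h⟩
    have hr : x ≠ R.right := fun h => hx ⟨R, hR, Or.inr h⟩
    have e1 : ∀ᶠ u in 𝓝 x, (R.left < x → R.left < u) ∧ (x < R.left → u < R.left) :=
      (eventually_imp_distrib_left.2 fun h => lt_mem_nhds h).and
        (eventually_imp_distrib_left.2 fun h => gt_mem_nhds h)
    have e2 : ∀ᶠ u in 𝓝 x, (R.right < x → R.right < u) ∧ (x < R.right → u < R.right) :=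
      (eventually_imp_distrib_left.2 fun h => lt_mem_nhds h).and
        (eventually_imp_distrib_left.2 fun h => gt_mem_nhds h)
    filter_upwards [e1, e2] with u h1 h2
    simp only [mem_Icc]
    grind
  obtain ⟨ε, hε, H⟩ := Metric.eventually_nhds_iff.1 key
  have H' : ∀ x', |x' - x| < ε → ∀ y, (x', y) ∈ unionOf F ↔ (x, y) ∈ unionOf F := by
    intro x' hx' y
    simp only [mem_unionOf]
    refine exists_congr fun R => and_congr_right fun hR => ?_
    exact and_congr_left fun _ => H hx' R hR
  have aux : ∀ u w, |u - x| < ε → |w - x| < ε → ∀ y, (u, y) ∈ interior (unionOf F) →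
      (w, y) ∈ interior (unionOf F) := by
    intro u w hu hw y h
    obtain ⟨δ, hδ, hI⟩ := mem_interior_iff_abs.1 h
    refine mem_interior_iff_abs.2 ⟨min δ (ε - |w - x|), by simp [hδ, hw], fun x' y' hx' hy' => ?_⟩
    have h1 : |x' - x| < ε := by
      have := abs_sub_le x' w x
      have := lt_of_lt_of_le hx' (min_le_right _ _)
      linarith
    rw [H' x' h1, ← H' u hu]
    exact hI u y' (by simpa using hδ) (lt_of_lt_of_le hy' (min_le_left _ _))
  have h0 : |x - x| < ε := by simpa using hε
  exact ⟨ε, hε, fun x' hx' y => ⟨H' x' hx' y, aux x' x hx' h0 y, aux x x' h0 hx' y⟩⟩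

/-! ### Concave corners and rays -/

/-- Near `v` the set is the complement of one open axis-parallel quadrant with apex `v`. -/
def IsConcaveAt (I : Set (ℝ × ℝ)) (v : ℝ × ℝ) : Prop :=
  ∃ s t : ℝ, (s = 1 ∨ s = -1) ∧ (t = 1 ∨ t = -1) ∧
    ∀ᶠ p in 𝓝 v, p ∈ I ↔ ¬ (0 < s * (p.1 - v.1) ∧ 0 < t * (p.2 - v.2))

theorem isConcaveAt_swap {I : Set (ℝ × ℝ)} {v : ℝ × ℝ} :
    IsConcaveAt (Prod.swap ⁻¹' I) v ↔ IsConcaveAt I v.swap := by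
  have key : ∀ (I : Set (ℝ × ℝ)) v, IsConcaveAt (Prod.swap ⁻¹' I) v → IsConcaveAt I v.swap := by
    rintro I v ⟨s, t, hs, ht, h⟩
    refine ⟨t, s, ht, hs, ?_⟩
    have hc : Tendsto Prod.swap (𝓝 v.swap) (𝓝 v) := continuous_swap.tendsto' _ _ v.swap_swap
    filter_upwards [hc.eventually h] with p hp
    rw [mem_preimage, Prod.swap_swap] at hp
    rw [hp]
    simp only [Prod.fst_swap, Prod.snd_swap]
    tauto
  refine ⟨key I v, fun h => ?_⟩
  have := key (Prod.swap ⁻¹' I) v.swap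
  rw [Prod.swap_swap] at this
  exact this h

/-- The points reached by vertical rays shot from concave corners through the interior. -/
def vrays (I : Set (ℝ × ℝ)) : Set (ℝ × ℝ) :=
  {q | ∃ w, IsConcaveAt I (q.1, w) ∧ w ≠ q.2 ∧ ∀ z ∈ uIcc w q.2, z ≠ w → (q.1, z) ∈ interior I}

/-- The points reached by horizontal rays shot from concave corners through the interior. -/
def hrays (I : Set (ℝ × ℝ)) : Set (ℝ × ℝ) := {q | q.swap ∈ vrays (Prod.swap ⁻¹' I)}

theorem IsConcaveAt.notMem_interior {I : Set (ℝ × ℝ)} {v : ℝ × ℝ} (h : IsConcaveAt I v) :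
    v ∉ interior I := by
  intro hv
  obtain ⟨s, t, hs, ht, h⟩ := h
  obtain ⟨ε, hε, H⟩ := eventually_nhds_prod_iff_abs.1 h
  obtain ⟨δ, hδ, K⟩ := mem_interior_iff_abs.1 hv
  obtain ⟨η, h0, h1, h2⟩ : ∃ η : ℝ, 0 < η ∧ η < ε ∧ η < δ :=
    ⟨min ε δ / 2, by positivity, by linarith [min_le_left ε δ, lt_min hε hδ],
      by linarith [min_le_right ε δ, lt_min hε hδ]⟩
  have hs' : |v.1 + s * η - v.1| = η := by
    rcases hs with rfl | rfl <;> simp [abs_of_pos h0]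
  have ht' : |v.2 + t * η - v.2| = η := by
    rcases ht with rfl | rfl <;> simp [abs_of_pos h0]
  refine (H _ _ (hs'.trans_lt h1) (ht'.trans_lt h1)).1
    (K _ _ (hs'.trans_lt h2) (ht'.trans_lt h2)) ?_
  rcases hs with rfl | rfl <;> rcases ht with rfl | rfl <;> simpa using h0

/-- Otherwise a small horizontal shift would preserve membership, yet it leads from the edge of the
missing quadrant, which belongs to the set, into that quadrant. Consequently all vertical rays lie
on finitely many lines. -/
theorem IsConcaveAt.fst_mem_xCoords {F : Finset Rect} {v : ℝ × ℝ}
    (h : IsConcaveAt (unionOf F) v) : v.1 ∈ xCoords F := by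
  by_contra hv
  obtain ⟨δ, hδ, K⟩ := exists_gap hv
  obtain ⟨s, t, hs, ht, h⟩ := h
  obtain ⟨ε, hε, H⟩ := eventually_nhds_prod_iff_abs.1 h
  obtain ⟨η, h0, h1, h2⟩ : ∃ η : ℝ, 0 < η ∧ η < ε ∧ η < δ :=
    ⟨min ε δ / 2, by positivity, by linarith [min_le_left ε δ, lt_min hε hδ],
      by linarith [min_le_right ε δ, lt_min hε hδ]⟩
  have hs' : |v.1 + s * η - v.1| = η := by
    rcases hs with rfl | rfl <;> simp [abs_of_pos h0]
  have ht' : |v.2 + t * η - v.2| = η := by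
    rcases ht with rfl | rfl <;> simp [abs_of_pos h0]
  have e1 := H _ _ (hs'.trans_lt h1) (ht'.trans_lt h1)
  have e2 := H v.1 _ (by simpa using hε) (ht'.trans_lt h1)
  have e3 := (K _ (hs'.trans_lt h2) (v.2 + t * η)).1
  rw [e1, e2] at e3
  rcases hs with rfl | rfl <;> rcases ht with rfl | rfl <;> simp [h0] at e3

theorem fst_mem_xCoords_of_mem_vrays {F : Finset Rect} {q : ℝ × ℝ}
    (h : q ∈ vrays (unionOf F)) : q.1 ∈ xCoords F := by
  obtain ⟨w, hw, -⟩ := h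
  exact hw.fst_mem_xCoords

theorem snd_mem_yCoords_of_mem_hrays {F : Finset Rect} {q : ℝ × ℝ}
    (h : q ∈ hrays (unionOf F)) : q.2 ∈ yCoords F := by
  rw [hrays, ← unionOf_swapAll] at h
  exact fst_mem_xCoords_of_mem_vrays h

/-- Points joined by a vertical segment in the interior are reached by the same vertical rays. -/
theorem mem_vrays_of_segment {I : Set (ℝ × ℝ)} {x y y' : ℝ} (h : (x, y) ∈ vrays I)
    (hs : ∀ z ∈ uIcc y y', (x, z) ∈ interior I) : (x, y') ∈ vrays I := by
  obtain ⟨w, hw, hne, hz⟩ := h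
  -- The source of the ray is not interior, so the new segment cannot pass over it.
  have hw' : w ∉ uIcc y y' := fun h => hw.notMem_interior (hs w h)
  refine ⟨w, hw, fun h => hw' (h ▸ right_mem_uIcc), fun z hz1 hzw => ?_⟩
  by_cases hzy : z ∈ uIcc y y'
  · exact hs z hzy
  · refine hz z ?_ hzw
    simp only [mem_uIcc] at *
    grind

/-! ### Free leaves -/

/-- The open segment `{x} × (a, b)` is a maximal vertical segment in the interior of `I`, and
neither of its ends is a concave corner. -/
structure Free (I : Set (ℝ × ℝ)) (x a b : ℝ) : Prop where
  lt : a < b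
  mem : ∀ y ∈ Ioo a b, (x, y) ∈ interior I
  bot : (x, a) ∉ interior I
  top : (x, b) ∉ interior I
  bot_conc : ¬ IsConcaveAt I (x, a)
  top_conc : ¬ IsConcaveAt I (x, b)

variable {F : Finset Rect}

/-- Of the four local quadrants, interior points just below `b` force the two lower ones. Both upper
ones would make the end interior, and exactly one would make it concave, so neither is present. -/
theorem exists_top_halfPlane {x a b : ℝ} (hab : a < b)
    (hm : ∀ y ∈ Ioo a b, (x, y) ∈ interior (unionOf F)) (hb : (x, b) ∉ interior (unionOf F))
    (hc : ¬ IsConcaveAt (unionOf F) (x, b)) :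
    ∃ ε > 0, ∀ x' y', |x' - x| < ε → |y' - b| < ε → ((x', y') ∈ unionOf F ↔ y' ≤ b) := by
  obtain ⟨A, B, C, D, ε, hε, H⟩ := unionOf_local F (x, b)
  obtain ⟨y, hy1, hy2⟩ := exists_between (max_lt hab (sub_lt_self b hε))
  rw [max_lt_iff] at hy1
  obtain ⟨δ, hδ, K⟩ := mem_interior_iff_abs.1 (hm y ⟨hy1.1, hy2⟩)
  obtain ⟨η, h0, h1, h2⟩ : ∃ η : ℝ, 0 < η ∧ η < ε ∧ η < δ :=
    ⟨min ε δ / 2, by positivity, by linarith [min_le_left ε δ, lt_min hε hδ],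
      by linarith [min_le_right ε δ, lt_min hε hδ]⟩
  have hy : |y - b| < ε := by rw [abs_lt]; constructor <;> linarith
  have k1 := (H (x + η) y (by simpa [abs_of_pos h0]) hy).1
    (K _ _ (by simpa [abs_of_pos h0]) (by simpa))
  have k2 := (H (x - η) y (by simpa [abs_of_pos h0]) hy).1
    (K _ _ (by simpa [abs_of_pos h0]) (by simpa))
  have hD : D := by grind
  have hC : C := by grind
  refine ⟨ε, hε, fun x' y' hx' hy' => ?_⟩
  rw [H x' y' hx' hy']
  have hAB : ¬ A ∧ ¬ B := by
    by_contra hAB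
    by_cases hA : A
    · by_cases hB : B
      · refine hb (mem_interior_iff_abs.2 ⟨ε, hε, fun u w hu hw => (H u w hu hw).2 ?_⟩)
        grind
      · refine hc ⟨-1, 1, Or.inr rfl, Or.inl rfl, eventually_nhds_prod_iff_abs.2
          ⟨ε, hε, fun u w hu hw => (H u w hu hw).trans ?_⟩⟩
        grind
    · refine hc ⟨1, 1, Or.inl rfl, Or.inl rfl, eventually_nhds_prod_iff_abs.2
        ⟨ε, hε, fun u w hu hw => (H u w hu hw).trans ?_⟩⟩
      grind
  grind

theorem exists_bot_halfPlane {x a b : ℝ} (hab : a < b)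
    (hm : ∀ y ∈ Ioo a b, (x, y) ∈ interior (unionOf F)) (ha : (x, a) ∉ interior (unionOf F))
    (hc : ¬ IsConcaveAt (unionOf F) (x, a)) :
    ∃ ε > 0, ∀ x' y', |x' - x| < ε → |y' - a| < ε → ((x', y') ∈ unionOf F ↔ a ≤ y') := by
  obtain ⟨A, B, C, D, ε, hε, H⟩ := unionOf_local F (x, a)
  obtain ⟨y, hy2, hy1⟩ := exists_between (lt_min hab (lt_add_of_pos_right a hε))
  rw [lt_min_iff] at hy1
  obtain ⟨δ, hδ, K⟩ := mem_interior_iff_abs.1 (hm y ⟨hy2, hy1.1⟩)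
  obtain ⟨η, h0, h1, h2⟩ : ∃ η : ℝ, 0 < η ∧ η < ε ∧ η < δ :=
    ⟨min ε δ / 2, by positivity, by linarith [min_le_left ε δ, lt_min hε hδ],
      by linarith [min_le_right ε δ, lt_min hε hδ]⟩
  have hy : |y - a| < ε := by rw [abs_lt]; constructor <;> linarith
  have k1 := (H (x + η) y (by simpa [abs_of_pos h0]) hy).1
    (K _ _ (by simpa [abs_of_pos h0]) (by simpa))
  have k2 := (H (x - η) y (by simpa [abs_of_pos h0]) hy).1
    (K _ _ (by simpa [abs_of_pos h0]) (by simpa))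
  have hA : A := by grind
  have hB : B := by grind
  refine ⟨ε, hε, fun x' y' hx' hy' => ?_⟩
  rw [H x' y' hx' hy']
  have hCD : ¬ C ∧ ¬ D := by
    by_contra hCD
    by_cases hC : C
    · by_cases hD : D
      · refine ha (mem_interior_iff_abs.2 ⟨ε, hε, fun u w hu hw => (H u w hu hw).2 ?_⟩)
        grind
      · refine hc ⟨1, -1, Or.inl rfl, Or.inr rfl, eventually_nhds_prod_iff_abs.2
          ⟨ε, hε, fun u w hu hw => (H u w hu hw).trans ?_⟩⟩
        grind
    · refine hc ⟨-1, -1, Or.inr rfl, Or.inr rfl, eventually_nhds_prod_iff_abs.2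
        ⟨ε, hε, fun u w hu hw => (H u w hu hw).trans ?_⟩⟩
      grind
  grind

/-- A set that looks like a horizontal half-plane near a point has no concave corner there. -/
theorem not_isConcaveAt_of_halfPlane {I : Set (ℝ × ℝ)} {v : ℝ × ℝ} {φ : ℝ → Prop} {ε : ℝ}
    (hε : 0 < ε) (h : ∀ x y, |x - v.1| < ε → |y - v.2| < ε → ((x, y) ∈ I ↔ φ y)) :
    ¬ IsConcaveAt I v := by
  rintro ⟨s, t, hs, ht, hc⟩
  obtain ⟨δ, hδ, H⟩ := eventually_nhds_prod_iff_abs.1 hc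
  obtain ⟨η, h0, h1, h2⟩ : ∃ η : ℝ, 0 < η ∧ η < ε ∧ η < δ :=
    ⟨min ε δ / 2, by positivity, by linarith [min_le_left ε δ, lt_min hε hδ],
      by linarith [min_le_right ε δ, lt_min hε hδ]⟩
  have hs' : |v.1 + s * η - v.1| = η := by
    rcases hs with rfl | rfl <;> simp [abs_of_pos h0]
  have ht' : |v.2 + t * η - v.2| = η := by
    rcases ht with rfl | rfl <;> simp [abs_of_pos h0]
  have e1 := H _ _ (hs'.trans_lt h2) (ht'.trans_lt h2)
  have e2 := H v.1 _ (by simpa using hδ) (ht'.trans_lt h2)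
  rw [h _ _ (hs'.trans_lt h1) (ht'.trans_lt h1)] at e1
  rw [h _ _ (by simpa using hε) (ht'.trans_lt h1), e1] at e2
  rcases hs with rfl | rfl <;> rcases ht with rfl | rfl <;> simp [h0] at e2

/-- The leaves near a free leaf are free. -/
theorem Free.eventually {x a b : ℝ} (h : Free (unionOf F) x a b) :
    ∀ᶠ x' in 𝓝 x, Free (unionOf F) x' a b := by
  obtain ⟨ε, hε, H⟩ := exists_top_halfPlane h.lt h.mem h.top h.top_conc
  obtain ⟨δ, hδ, K⟩ := exists_bot_halfPlane h.lt h.mem h.bot h.bot_conc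
  -- Near the two ends the half-plane pictures decide interiority for the neighbouring leaves; the
  -- compact middle part is handled by the tube lemma.
  have hsub : ({x} : Set ℝ) ×ˢ Icc (a + δ / 2) (b - ε / 2) ⊆ interior (unionOf F) := by
    rintro ⟨u, y⟩ ⟨rfl, hy1, hy2⟩
    exact h.mem y ⟨by linarith, by linarith⟩
  obtain ⟨U, V, hU, -, hxU, hV, hUV⟩ :=
    generalized_tube_lemma isCompact_singleton isCompact_Icc isOpen_interior hsub
  filter_upwards [hU.mem_nhds (hxU rfl), Metric.ball_mem_nhds x hε, Metric.ball_mem_nhds x hδ]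
    with u hu hu1 hu2
  rw [Metric.mem_ball, Real.dist_eq] at hu1 hu2
  have pos1 : 0 < ε - |u - x| := sub_pos.2 hu1
  have pos2 : 0 < δ - |u - x| := sub_pos.2 hu2
  have near1 : ∀ w, |w - u| < ε - |u - x| → |w - x| < ε := fun w hw => by
    linarith [abs_sub_le w u x]
  have near2 : ∀ w, |w - u| < δ - |u - x| → |w - x| < δ := fun w hw => by
    linarith [abs_sub_le w u x]
  have T : ∀ w y, |w - u| < ε - |u - x| → |y - b| < ε - |u - x| →
      ((w, y) ∈ unionOf F ↔ y ≤ b) := fun w y hw hy =>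
    H w y (near1 w hw) (by linarith [abs_nonneg (u - x)])
  have B : ∀ w y, |w - u| < δ - |u - x| → |y - a| < δ - |u - x| →
      ((w, y) ∈ unionOf F ↔ a ≤ y) := fun w y hw hy =>
    K w y (near2 w hw) (by linarith [abs_nonneg (u - x)])
  refine ⟨h.lt, fun y hy => ?_, fun hi => ?_, fun hi => ?_, not_isConcaveAt_of_halfPlane pos2 B,
    not_isConcaveAt_of_halfPlane pos1 T⟩
  · rcases lt_or_ge y (a + δ / 2) with hya | hya
    · refine mem_interior_iff_abs.2 ⟨min (δ - |u - x|) (min (y - a) (δ / 2)),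
        by simp [hy.1, hδ, hu2], fun w z hw hz => ?_⟩
      simp only [lt_min_iff] at hw hz
      have hz' := abs_lt.1 hz.2.1
      have hz'' := abs_lt.1 hz.2.2
      exact (K w z (near2 w hw.1) (abs_lt.2 ⟨by linarith, by linarith⟩)).2 (by linarith)
    rcases lt_or_ge (b - ε / 2) y with hyb | hyb
    · refine mem_interior_iff_abs.2 ⟨min (ε - |u - x|) (min (b - y) (ε / 2)),
        by simp [hy.2, hε, hu1], fun w z hw hz => ?_⟩
      simp only [lt_min_iff] at hw hz
      have hz' := abs_lt.1 hz.2.1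
      have hz'' := abs_lt.1 hz.2.2
      exact (H w z (near1 w hw.1) (abs_lt.2 ⟨by linarith, by linarith⟩)).2 (by linarith)
    · exact hUV ⟨hu, hV ⟨hya, hyb⟩⟩
  · obtain ⟨η, hη, L⟩ := mem_interior_iff_abs.1 hi
    have pos : 0 < min η (δ - |u - x|) := lt_min hη pos2
    have hw : |a - min η (δ - |u - x|) / 2 - a| = min η (δ - |u - x|) / 2 := by
      rw [sub_sub_cancel_left, abs_neg, abs_of_pos (by positivity)]
    have := (B u (a - min η (δ - |u - x|) / 2) (by simpa using hu2)
      (by rw [hw]; linarith [min_le_right η (δ - |u - x|)])).1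
      (L _ _ (by simpa using hη) (by dsimp only; rw [hw]; linarith [min_le_left η (δ - |u - x|)]))
    linarith
  · obtain ⟨η, hη, L⟩ := mem_interior_iff_abs.1 hi
    have pos : 0 < min η (ε - |u - x|) := lt_min hη pos1
    have hw : |b + min η (ε - |u - x|) / 2 - b| = min η (ε - |u - x|) / 2 := by
      rw [add_sub_cancel_left, abs_of_pos (by positivity)]
    have := (T u (b + min η (ε - |u - x|) / 2) (by simpa using hu1)
      (by rw [hw]; linarith [min_le_right η (ε - |u - x|)])).1
      (L _ _ (by simpa using hη) (by dsimp only; rw [hw]; linarith [min_le_left η (ε - |u - x|)]))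
    linarith

theorem exists_abs_lt_of_mem_unionOf (F : Finset Rect) :
    ∃ M : ℝ, ∀ p ∈ unionOf F, |p.1| < M ∧ |p.2| < M := by
  obtain ⟨M, hM⟩ := (isCompact_unionOf F).isBounded.exists_norm_le
  refine ⟨M + 1, fun p hp => ?_⟩
  have := hM p hp
  rw [Prod.norm_def, max_le_iff, Real.norm_eq_abs, Real.norm_eq_abs] at this
  exact ⟨by linarith [this.1], by linarith [this.2]⟩

/-- Every interior point lies on a maximal vertical segment in the interior. -/
theorem exists_leaf {x y : ℝ} (h : (x, y) ∈ interior (unionOf F)) :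
    ∃ a b, a < y ∧ y < b ∧ (∀ z ∈ Ioo a b, (x, z) ∈ interior (unionOf F)) ∧
      (x, a) ∉ interior (unionOf F) ∧ (x, b) ∉ interior (unionOf F) := by
  obtain ⟨M, hM⟩ := exists_abs_lt_of_mem_unionOf F
  have hy := abs_lt.1 (hM _ (interior_subset h)).2
  refine exists_maximal_Ioo (U := {z | (x, z) ∈ interior (unionOf F)})
    (isOpen_interior.preimage (by fun_prop)) h ⟨-M, hy.1.le, fun hi => ?_⟩ ⟨M, hy.2.le, fun hi => ?_⟩
  · have := abs_lt.1 (hM _ (interior_subset hi)).2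
    exact lt_irrefl _ this.1
  · have := abs_lt.1 (hM _ (interior_subset hi)).2
    exact lt_irrefl _ this.2

/-- A concave end of the maximal segment through the point would shoot a ray along that segment onto
the point. -/
theorem exists_free {x y : ℝ} (h : (x, y) ∈ interior (unionOf F) \ vrays (unionOf F)) :
    ∃ a b, a < y ∧ y < b ∧ Free (unionOf F) x a b := by
  obtain ⟨a, b, ha, hb, hm, h1, h2⟩ := exists_leaf h.1
  refine ⟨a, b, ha, hb, ha.trans hb, hm, h1, h2, fun hc => ?_, fun hc => ?_⟩
  · refine h.2 ⟨a, hc, ha.ne, fun z hz hza => hm z ?_⟩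
    rw [uIcc_of_le ha.le] at hz
    exact ⟨lt_of_le_of_ne hz.1 hza.symm, hz.2.trans_lt hb⟩
  · refine h.2 ⟨b, hc, hb.ne', fun z hz hza => hm z ?_⟩
    rw [uIcc_of_ge hb.le] at hz
    exact ⟨ha.trans_le hz.1, lt_of_le_of_ne hz.2 hza⟩

/-- A ray reaching the leaf would start at one of its ends, inside it, or beyond an end. Ends are
not concave, interior points are not concave, and a ray from beyond would pass through a
non-interior end. -/
theorem Free.notMem_vrays {I : Set (ℝ × ℝ)} {x a b y : ℝ} (h : Free I x a b) (hy : y ∈ Ioo a b) :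
    (x, y) ∉ vrays I := by
  rintro ⟨w, hw, hne, hz⟩
  have hwa : w ≠ a := fun e => h.bot_conc (e ▸ hw)
  have hwb : w ≠ b := fun e => h.top_conc (e ▸ hw)
  have hwi : w ∉ Ioo a b := fun e => hw.notMem_interior (h.mem w e)
  rcases lt_or_ge w a with hlt | hge
  · refine h.bot (hz a ?_ hwa.symm)
    rw [mem_uIcc]
    exact Or.inl ⟨hlt.le, hy.1.le⟩
  · have : b < w := lt_of_le_of_ne
      (not_lt.1 fun hb => hwi ⟨lt_of_le_of_ne hge hwa.symm, hb⟩) hwb.symm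
    refine h.top (hz b ?_ hwb.symm)
    rw [mem_uIcc]
    exact Or.inr ⟨hy.2.le, this.le⟩

theorem Free.unique {I : Set (ℝ × ℝ)} {x a b a' b' y : ℝ} (h : Free I x a b) (h' : Free I x a' b')
    (hy : y ∈ Ioo a b) (hy' : y ∈ Ioo a' b') : a = a' ∧ b = b' := by
  obtain ⟨h1, h2⟩ := hy
  obtain ⟨h3, h4⟩ := hy'
  constructor <;> apply le_antisymm <;> by_contra! hlt
  · exact h.bot (h'.mem a ⟨hlt, by linarith⟩)
  · exact h'.bot (h.mem a' ⟨hlt, by linarith⟩)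
  · exact h'.top (h.mem b' ⟨by linarith, hlt⟩)
  · exact h.top (h'.mem b ⟨by linarith, hlt⟩)

/-! ### Strips -/

/-- A maximal rectangle swept by free leaves. -/
structure IsStrip (I : Set (ℝ × ℝ)) (S : Rect) : Prop where
  free : ∀ x ∈ Ioo S.left S.right, Free I x S.bottom S.top
  left_not_free : ¬ Free I S.left S.bottom S.top
  right_not_free : ¬ Free I S.right S.bottom S.top

/-- The abscissae whose leaf is free with the ends `a`, `b` form a bounded open set, and a maximal
interval of it spans the strip. -/
theorem exists_strip {p : ℝ × ℝ} (h : p ∈ interior (unionOf F) \ vrays (unionOf F)) :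
    ∃ S, IsStrip (unionOf F) S ∧ p ∈ S.openSet := by
  obtain ⟨x, y⟩ := p
  obtain ⟨a, b, ha, hb, hf⟩ := exists_free h
  obtain ⟨M, hM⟩ := exists_abs_lt_of_mem_unionOf F
  have hx := abs_lt.1 (hM _ (interior_subset h.1)).1
  have hn : ∀ u, Free (unionOf F) u a b → |u| < M := fun u hu =>
    (hM _ (interior_subset (hu.mem y ⟨ha, hb⟩))).1
  obtain ⟨l, r, hl, hr, hlr, hl', hr'⟩ :=
    exists_maximal_Ioo (U := {u | Free (unionOf F) u a b})
    (isOpen_iff_mem_nhds.2 fun u hu => hu.eventually) hf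
    ⟨-M, hx.1.le, fun hi => lt_irrefl _ (abs_lt.1 (hn _ hi)).1⟩
    ⟨M, hx.2.le, fun hi => lt_irrefl _ (abs_lt.1 (hn _ hi)).2⟩
  exact ⟨⟨l, r, a, b, hl.trans hr, ha.trans hb⟩, ⟨fun u hu => hlr hu, hl', hr'⟩,
    ⟨hl, hr⟩, ha, hb⟩

namespace IsStrip

theorem openSet_subset {I : Set (ℝ × ℝ)} {S : Rect} (hS : IsStrip I S) :
    S.openSet ⊆ interior I \ vrays I :=
  fun p hp => ⟨(hS.free p.1 hp.1).mem p.2 hp.2, (hS.free p.1 hp.1).notMem_vrays hp.2⟩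

variable {S : Rect}

theorem toSet_subset (hS : IsStrip (unionOf F) S) : S.toSet ⊆ unionOf F := by
  rw [← S.closure_openSet]
  exact closure_minimal (fun p hp => interior_subset (hS.openSet_subset hp).1)
    (isCompact_unionOf F).isClosed

/-- A frontier point in the cut interior would lie on a free leaf. Leaves near it have the same ends
and some belong to the strip, so its leaf has the strip's ends. The point is then on a vertical side
whose leaf is free, against maximality. -/
theorem frontier_disjoint (hS : IsStrip (unionOf F) S) {p : ℝ × ℝ} (hp : p ∈ S.toSet)
    (hpo : p ∉ S.openSet) : p ∉ interior (unionOf F) \ vrays (unionOf F) := by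
  intro h
  obtain ⟨x, y⟩ := p
  obtain ⟨a, b, ha, hb, hf⟩ := exists_free h
  have hlr := S.left_lt_right
  have hbt := S.bottom_lt_top
  obtain ⟨⟨h1, h2⟩, h3, h4⟩ := hp
  dsimp only at h1 h2 h3 h4
  obtain ⟨ε, hε, H⟩ := Metric.eventually_nhds_iff.1 hf.eventually
  obtain ⟨u, hu, hu1, hu2⟩ : ∃ u, |u - x| < ε ∧ S.left < u ∧ u < S.right := by
    rcases h1.eq_or_lt with h | h
    · obtain ⟨u, hu1, hu2⟩ := exists_between (lt_min hlr (lt_add_of_pos_right S.left hε))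
      rw [lt_min_iff] at hu2
      exact ⟨u, abs_lt.2 ⟨by linarith, by linarith⟩, hu1, hu2.1⟩
    · obtain ⟨u, hu1, hu2⟩ := exists_between (max_lt h (sub_lt_self x hε))
      rw [max_lt_iff] at hu1
      exact ⟨u, abs_lt.2 ⟨by linarith, by linarith⟩, hu1.1, hu2.trans_le h2⟩
  have hfu := H hu
  have hsu := hS.free u ⟨hu1, hu2⟩
  have h3' : S.bottom < y := lt_of_le_of_ne h3 fun e => hsu.bot (e ▸ hfu.mem y ⟨ha, hb⟩)
  have h4' : y < S.top := lt_of_le_of_ne h4 fun e => hsu.top (e ▸ hfu.mem y ⟨ha, hb⟩)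
  obtain ⟨rfl, rfl⟩ := hfu.unique hsu ⟨ha, hb⟩ ⟨h3', h4'⟩
  rcases h1.eq_or_lt with rfl | h1'
  · exact hS.left_not_free hf
  rcases h2.eq_or_lt with rfl | h2'
  · exact hS.right_not_free hf
  exact hpo ⟨⟨h1', h2'⟩, h3', h4'⟩

/-- The strips are the components of the interior cut along the vertical rays. -/
theorem subset_openSet (hS : IsStrip (unionOf F) S) {D : Set (ℝ × ℝ)} (hD : IsPreconnected D)
    (hsub : D ⊆ interior (unionOf F) \ vrays (unionOf F)) (hne : (D ∩ S.openSet).Nonempty) :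
    D ⊆ S.openSet := by
  refine hD.subset_left_of_subset_union S.isOpen_openSet S.isClosed_toSet.isOpen_compl
    (disjoint_compl_right.mono_left S.openSet_subset_toSet) (fun p hp => ?_) hne
  by_cases h : p ∈ S.openSet
  · exact Or.inl h
  · exact Or.inr fun hpS => hS.frontier_disjoint hpS h (hsub hp)

theorem eq_of_mem {S' : Rect} (hS : IsStrip (unionOf F) S) (hS' : IsStrip (unionOf F) S')
    {p : ℝ × ℝ} (h : p ∈ S.openSet) (h' : p ∈ S'.openSet) : S = S' :=
  Rect.openSet_injective <| Subset.antisymm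
    (hS'.subset_openSet S.isPreconnected_openSet hS.openSet_subset ⟨p, h, h'⟩)
    (hS.subset_openSet S'.isPreconnected_openSet hS'.openSet_subset ⟨p, h', h⟩)

/-- The region does not change across a line that carries no side of `F`, so leaves would continue
past a side of the strip on such a line. This makes the base rectangles finite in number. -/
theorem coords (hS : IsStrip (unionOf F) S) : S.left ∈ xCoords F ∧ S.right ∈ xCoords F ∧
    S.bottom ∈ yCoords F ∧ S.top ∈ yCoords F := by
  have hlr := S.left_lt_right
  have hbt := S.bottom_lt_top
  have key : ∀ c, c ∉ xCoords F → ∀ x, Free (unionOf F) x S.bottom S.top →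
      (∀ y, (c, y) ∈ interior (unionOf F) ↔ (x, y) ∈ interior (unionOf F)) →
      Free (unionOf F) c S.bottom S.top := fun c hc x hx h =>
    ⟨hbt, fun y hy => (h y).2 (hx.mem y hy), fun hi => hx.bot ((h _).1 hi),
      fun hi => hx.top ((h _).1 hi), fun hk => hc hk.fst_mem_xCoords,
      fun hk => hc hk.fst_mem_xCoords⟩
  have ykey : ∀ c, c ∉ yCoords F → ∃ ε > 0, ∀ y, |y - c| < ε → ∀ x,
      ((x, y) ∈ interior (unionOf F) ↔ (x, c) ∈ interior (unionOf F)) := by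
    intro c hc
    obtain ⟨ε, hε, H⟩ := exists_gap hc
    refine ⟨ε, hε, fun y hy x => ?_⟩
    have := (H y hy x).2
    rwa [unionOf_swapAll, interior_swap_preimage] at this
  obtain ⟨x, hx⟩ := nonempty_Ioo.2 hlr
  have hf := hS.free x hx
  refine ⟨?_, ?_, ?_, ?_⟩ <;> by_contra hc
  · obtain ⟨ε, hε, H⟩ := exists_gap hc
    obtain ⟨u, hu1, hu2⟩ := exists_between (lt_min hlr (lt_add_of_pos_right S.left hε))
    rw [lt_min_iff] at hu2
    exact hS.left_not_free (key _ hc u (hS.free u ⟨hu1, hu2.1⟩) fun y =>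
      (H u (abs_lt.2 ⟨by linarith, by linarith⟩) y).2.symm)
  · obtain ⟨ε, hε, H⟩ := exists_gap hc
    obtain ⟨u, hu1, hu2⟩ := exists_between (max_lt hlr (sub_lt_self S.right hε))
    rw [max_lt_iff] at hu1
    exact hS.right_not_free (key _ hc u (hS.free u ⟨hu1.1, hu2⟩) fun y =>
      (H u (abs_lt.2 ⟨by linarith, by linarith⟩) y).2.symm)
  · obtain ⟨ε, hε, H⟩ := ykey _ hc
    obtain ⟨u, hu1, hu2⟩ := exists_between (lt_min hbt (lt_add_of_pos_right S.bottom hε))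
    rw [lt_min_iff] at hu2
    exact hf.bot ((H u (abs_lt.2 ⟨by linarith, by linarith⟩) x).1 (hf.mem u ⟨hu1, hu2.1⟩))
  · obtain ⟨ε, hε, H⟩ := ykey _ hc
    obtain ⟨u, hu1, hu2⟩ := exists_between (max_lt hbt (sub_lt_self S.top hε))
    rw [max_lt_iff] at hu1
    exact hf.top ((H u (abs_lt.2 ⟨by linarith, by linarith⟩) x).1 (hf.mem u ⟨hu1.1, hu2⟩))

/-- A rectangle in the region that reaches a strip does not cross its upper and lower sides. -/
theorem vertical_bounds (hS : IsStrip (unionOf F) S) {R : Rect} (hR : R.toSet ⊆ unionOf F)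
    {x y : ℝ} (hx : x ∈ Ioo S.left S.right) (hy : y ∈ Ioo S.bottom S.top)
    (hx' : x ∈ Icc R.left R.right) (hy' : y ∈ Ioo R.bottom R.top) :
    S.bottom ≤ R.bottom ∧ R.top ≤ S.top := by
  -- On a common abscissa in both open ranges, a horizontal side of `S` strictly inside `R` would
  -- contain an interior point, but the ends of a leaf are not interior.
  obtain ⟨u, hu, hu'⟩ : ∃ u, u ∈ Ioo S.left S.right ∧ u ∈ Ioo R.left R.right := by
    have hlr := R.left_lt_right
    obtain ⟨u, h1, h2⟩ : ∃ u, max S.left R.left < u ∧ u < min S.right R.right := by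
      refine exists_between (max_lt (lt_min (hx.1.trans hx.2) ?_) (lt_min ?_ hlr))
      · exact hx.1.trans_le hx'.2
      · exact hx'.1.trans_lt hx.2
    rw [max_lt_iff] at h1
    rw [lt_min_iff] at h2
    exact ⟨u, ⟨h1.1, h2.1⟩, h1.2, h2.2⟩
  have hi := R.openSet_subset_interior hR
  constructor <;> by_contra! h
  · exact (hS.free u hu).bot (hi ⟨hu', h, hy.1.trans hy'.2⟩)
  · exact (hS.free u hu).top (hi ⟨hu', hy'.1.trans hy.2, h⟩)

end IsStrip

/-! ### Snapping the vertical sides of rectangles to the ends of strips -/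

/-- A strip whose vertical extent contains `[b, d]`. -/
def IsWideStrip (I : Set (ℝ × ℝ)) (b d : ℝ) (S : Rect) : Prop :=
  IsStrip I S ∧ S.bottom ≤ b ∧ d ≤ S.top

open Classical in
/-- The abscissa to which a vertical side `{x} × [b, d]` is moved: if the side lies in a strip, it
goes to the left or right end of the strip, according to its position relative to the
threshold `t`. -/
def snap (I : Set (ℝ × ℝ)) (b d t x : ℝ) : ℝ :=
  if h : ∃ S, IsWideStrip I b d S ∧ x ∈ Ioo S.left S.right then
    if x < h.choose.left + t * (h.choose.right - h.choose.left) then h.choose.left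
    else h.choose.right
  else x

variable {b d t : ℝ}

/-- Strips wide for the same `[b, d]` share heights, so overlapping abscissae give a common point.
Hence the choice made in `snap` is immaterial. -/
theorem IsWideStrip.eq_or_disjoint {S S' : Rect} (hS : IsWideStrip (unionOf F) b d S)
    (hS' : IsWideStrip (unionOf F) b d S') (hbd : b < d) :
    S = S' ∨ S.right ≤ S'.left ∨ S'.right ≤ S.left := by
  by_contra! h
  obtain ⟨y, hy1, hy2⟩ := exists_between hbd
  obtain ⟨x, hx1, hx2⟩ := exists_between (max_lt (lt_min S.left_lt_right h.2.2)
    (lt_min h.2.1 S'.left_lt_right))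
  rw [max_lt_iff] at hx1
  rw [lt_min_iff] at hx2
  exact h.1 (hS.1.eq_of_mem hS'.1 (p := (x, y))
    ⟨⟨hx1.1, hx2.1⟩, hS.2.1.trans_lt hy1, hy2.trans_le hS.2.2⟩
    ⟨⟨hx1.2, hx2.2⟩, hS'.2.1.trans_lt hy1, hy2.trans_le hS'.2.2⟩)

theorem snap_of_mem {S : Rect} (hS : IsWideStrip (unionOf F) b d S) (hbd : b < d) {x : ℝ}
    (hx : x ∈ Ioo S.left S.right) :
    snap (unionOf F) b d t x = if x < S.left + t * (S.right - S.left) then S.left else S.right := by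
  have h : ∃ S, IsWideStrip (unionOf F) b d S ∧ x ∈ Ioo S.left S.right := ⟨S, hS, hx⟩
  have he : h.choose = S := by
    rcases h.choose_spec.1.eq_or_disjoint hS hbd with h' | h' | h'
    · exact h'
    · exact absurd (h.choose_spec.2.2.trans_le h') (not_lt.2 hx.1.le)
    · exact absurd (hx.2.trans_le h') (not_lt.2 h.choose_spec.2.1.le)
  rw [snap, dif_pos h, he]

/-- Neither the case nor the strip depends on the threshold, which allows integration over it. -/
theorem snap_cases (hbd : b < d) (x : ℝ) :
    ((¬ ∃ S, IsWideStrip (unionOf F) b d S ∧ x ∈ Ioo S.left S.right) ∧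
      ∀ t, snap (unionOf F) b d t x = x) ∨
    ∃ S, IsWideStrip (unionOf F) b d S ∧ x ∈ Ioo S.left S.right ∧ ∀ t,
      snap (unionOf F) b d t x =
        if x < S.left + t * (S.right - S.left) then S.left else S.right := by
  by_cases h : ∃ S, IsWideStrip (unionOf F) b d S ∧ x ∈ Ioo S.left S.right
  · obtain ⟨S, hS, hx⟩ := h
    exact Or.inr ⟨S, hS, hx, fun t => snap_of_mem hS hbd hx⟩
  · exact Or.inl ⟨h, fun t => by rw [snap, dif_neg h]⟩

/-- Here `x` need not lie in `S`. Together with `le_snap` this shows that a rectangle straddling the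
threshold line of a wide strip is stretched over its whole width. -/
theorem snap_le {S : Rect} (hS : IsWideStrip (unionOf F) b d S) (hbd : b < d)
    (ht : t ∈ Ioo (0 : ℝ) 1) {x : ℝ} (hx : x < S.left + t * (S.right - S.left)) :
    snap (unionOf F) b d t x ≤ S.left := by
  have hlr := S.left_lt_right
  have hxr : x < S.right := by nlinarith [ht.2]
  rcases snap_cases (F := F) hbd x with ⟨h, h'⟩ | ⟨S', hS', hx', h'⟩
  · rw [h']
    by_contra! hlt
    exact h ⟨S, hS, hlt, hxr⟩
  · rw [h']
    rcases hS.eq_or_disjoint hS' hbd with rfl | h | h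
    · rw [if_pos hx]
    · exact absurd (hxr.trans_le h) (not_lt.2 hx'.1.le)
    · have := S'.left_lt_right
      split_ifs <;> linarith

theorem le_snap {S : Rect} (hS : IsWideStrip (unionOf F) b d S) (hbd : b < d)
    (ht : t ∈ Ioo (0 : ℝ) 1) {x : ℝ} (hx : S.left + t * (S.right - S.left) ≤ x) :
    S.right ≤ snap (unionOf F) b d t x := by
  have hlr := S.left_lt_right
  have hxl : S.left < x := by nlinarith [ht.1]
  rcases snap_cases (F := F) hbd x with ⟨h, h'⟩ | ⟨S', hS', hx', h'⟩
  · rw [h']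
    by_contra! hlt
    exact h ⟨S, hS, hxl, hlt⟩
  · rw [h']
    rcases hS.eq_or_disjoint hS' hbd with rfl | h | h
    · rw [if_neg (not_lt.2 hx)]
    · have := S'.left_lt_right
      split_ifs <;> linarith
    · exact absurd (hx'.2.trans_le h) (not_lt.2 hxl.le)

/-- The two sides of a rectangle never change order; at worst they coincide and the rectangle
disappears. -/
theorem snap_mono (hbd : b < d) (ht : t ∈ Ioo (0 : ℝ) 1) {x x' : ℝ} (hx : x ≤ x') :
    snap (unionOf F) b d t x ≤ snap (unionOf F) b d t x' := by
  rcases snap_cases (F := F) hbd x with ⟨h, e⟩ | ⟨S, hS, hxS, e⟩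
  · rcases snap_cases (F := F) hbd x' with ⟨h', e'⟩ | ⟨S', hS', hxS', e'⟩
    · rwa [e, e']
    · rw [e, e']
      have : x ≤ S'.left := by
        by_contra! hlt
        exact h ⟨S', hS', hlt, hx.trans_lt hxS'.2⟩
      have := S'.left_lt_right
      split_ifs <;> linarith
  · have hlr := S.left_lt_right
    rcases lt_or_ge x (S.left + t * (S.right - S.left)) with h1 | h1
    · refine (snap_le hS hbd ht h1).trans ?_
      rcases snap_cases (F := F) hbd x' with ⟨h', e'⟩ | ⟨S', hS', hxS', e'⟩
      · rw [e']
        exact (hxS.1.trans_le hx).le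
      · rw [e']
        have := S'.left_lt_right
        have h2 : S.left ≤ S'.left := by
          rcases hS.eq_or_disjoint hS' hbd with rfl | h | h
          · rfl
          · linarith
          · linarith [hxS.1, hxS'.2]
        split_ifs <;> linarith
    · refine le_trans ?_ (le_snap hS hbd ht (h1.trans hx))
      rw [e, if_neg (not_lt.2 h1)]

/-- On average over the threshold, a side is not moved. -/
theorem integral_snap (F : Finset Rect) (hbd : b < d) (x : ℝ) :
    MeasureTheory.IntegrableOn (fun t => snap (unionOf F) b d t x) (Ioo 0 1) ∧
      ∫ t in Ioo (0 : ℝ) 1, snap (unionOf F) b d t x = x := by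
  rcases snap_cases (F := F) hbd x with ⟨-, e⟩ | ⟨S, -, hx, e⟩
  · simp [e]
  · have hw : 0 < S.right - S.left := sub_pos.2 S.left_lt_right
    -- With `τ` the relative position, the side goes left exactly for `t > τ`, a set of measure `1 -
    -- τ`; the mean is `S.right - (1 - τ) * (S.right - S.left) = x`.
    set τ := (x - S.left) / (S.right - S.left) with hτ
    have hx' : x = S.left + τ * (S.right - S.left) := by
      rw [hτ, div_mul_cancel₀ _ hw.ne']
      ring
    have h0 : 0 < τ := div_pos (sub_pos.2 hx.1) hw
    have h1 : τ < 1 := by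
      rw [hτ, div_lt_one hw]
      linarith [hx.2]
    have hfun : (fun t => snap (unionOf F) b d t x) =
        fun t => S.right + (Ioi τ).indicator (fun _ => S.left - S.right) t := by
      funext t
      rw [e]
      have : x < S.left + t * (S.right - S.left) ↔ t ∈ Ioi τ := by
        conv_lhs => rw [hx']
        rw [add_lt_add_iff_left, mul_lt_mul_iff_left₀ hw, mem_Ioi]
      by_cases ht : t ∈ Ioi τ
      · rw [if_pos (this.2 ht), indicator_of_mem ht]
        ring
      · rw [if_neg (fun h => ht (this.1 h)), indicator_of_notMem ht, add_zero]
    have hc : ∀ c : ℝ, MeasureTheory.IntegrableOn (fun _ : ℝ => c) (Ioo 0 1) := fun c => by simp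
    have hi : MeasureTheory.IntegrableOn
        (fun t => (Ioi τ).indicator (fun _ => S.left - S.right) t) (Ioo 0 1) :=
      MeasureTheory.Integrable.indicator (hc _) measurableSet_Ioi
    rw [hfun]
    refine ⟨(hc _).add hi, ?_⟩
    rw [MeasureTheory.integral_add (hc _) hi, MeasureTheory.setIntegral_indicator measurableSet_Ioi,
      Ioo_inter_Ioi, max_eq_right h0.le]
    simp only [MeasureTheory.setIntegral_const, MeasureTheory.measureReal_def, Real.volume_Ioo,
      smul_eq_mul]
    rw [ENNReal.toReal_ofReal (by linarith), ENNReal.toReal_ofReal (by linarith)]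
    linear_combination -hx'

/-- The rectangle with snapped vertical sides, or nothing if the sides coincide. -/
def snapRect (I : Set (ℝ × ℝ)) (t : ℝ) (R : Rect) : Finset Rect :=
  if h : snap I R.bottom R.top t R.left < snap I R.bottom R.top t R.right then
    {⟨_, _, R.bottom, R.top, h, R.bottom_lt_top⟩}
  else ∅

theorem mem_snapRect {I : Set (ℝ × ℝ)} {R Q : Rect} :
    Q ∈ snapRect I t R ↔ Q.left = snap I R.bottom R.top t R.left ∧
      Q.right = snap I R.bottom R.top t R.right ∧ Q.bottom = R.bottom ∧ Q.top = R.top := by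
  rw [snapRect]
  split_ifs with h
  · rw [Finset.mem_singleton, Rect.ext_iff]
  · simp only [Finset.notMem_empty, false_iff]
    rintro ⟨h1, h2, -⟩
    exact h (h1 ▸ h2 ▸ Q.left_lt_right)

/-! ### Cost of the snapped rectangles -/

theorem cost_snapRect_le (ht : t ∈ Ioo (0 : ℝ) 1) {α : ℝ} (hα : 0 ≤ α) (β : ℝ) (R : Rect) :
    cost α β (snapRect (unionOf F) t R) ≤ α + β * ((snap (unionOf F) R.bottom R.top t R.right -
      snap (unionOf F) R.bottom R.top t R.left) * (R.top - R.bottom)) := by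
  rw [snapRect]
  split_ifs with h
  · rw [cost, Finset.sum_singleton, Rect.area]
  · have := le_antisymm (snap_mono (F := F) R.bottom_lt_top ht R.left_lt_right.le) (not_lt.1 h)
    rw [this, cost, Finset.sum_empty, sub_self, zero_mul, mul_zero, add_zero]
    exact hα

/-- Only an inequality, since rectangles that coincide after snapping are paid for once. -/
theorem cost_biUnion_le {α β : ℝ} (hα : 0 ≤ α) (hβ : 0 ≤ β) (C : Finset Rect)
    (f : Rect → Finset Rect) [DecidableEq Rect] :
    cost α β (C.biUnion f) ≤ ∑ R ∈ C, cost α β (f R) := by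
  induction C using Finset.induction_on with
  | empty => simp [cost]
  | insert R C hR ih =>
    rw [Finset.biUnion_insert, Finset.sum_insert hR]
    have h : cost α β (f R ∪ C.biUnion f) ≤ cost α β (f R) + cost α β (C.biUnion f) := by
      rw [cost, cost, cost, ← Finset.sum_union_inter, le_add_iff_nonneg_right]
      exact Finset.sum_nonneg fun Q _ => add_nonneg hα (mul_nonneg hβ Q.area_pos.le)
    linarith

/-- For a suitable threshold, snapping does not increase the cost. -/
theorem exists_threshold (α β : ℝ) (C : Finset Rect) : ∃ t ∈ Ioo (0 : ℝ) 1,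
    ∑ R ∈ C, (α + β * ((snap (unionOf F) R.bottom R.top t R.right -
      snap (unionOf F) R.bottom R.top t R.left) * (R.top - R.bottom))) ≤ cost α β C := by
  have hsub : ∀ R : Rect, MeasureTheory.IntegrableOn (fun t => snap (unionOf F) R.bottom R.top t
      R.right - snap (unionOf F) R.bottom R.top t R.left) (Ioo 0 1) := fun R =>
    (integral_snap F R.bottom_lt_top R.right).1.sub (integral_snap F R.bottom_lt_top R.left).1
  have hint : ∀ R ∈ C, MeasureTheory.Integrable (fun t => α + β * ((snap (unionOf F) R.bottom R.top
      t R.right - snap (unionOf F) R.bottom R.top t R.left) * (R.top - R.bottom)))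
      (MeasureTheory.volume.restrict (Ioo 0 1)) := fun R _ =>
    (MeasureTheory.integrable_const α).add (((hsub R).mul_const _).const_mul β)
  -- Some threshold does no worse than the average, and the average is the old cost.
  obtain ⟨t, ht, h⟩ := MeasureTheory.exists_le_setAverage (μ := MeasureTheory.volume)
    (s := Ioo (0 : ℝ) 1) (by simp) (by simp) (MeasureTheory.integrable_finsetSum C hint)
  refine ⟨t, ht, h.trans_eq ?_⟩
  rw [MeasureTheory.setAverage_eq, MeasureTheory.integral_finsetSum C hint, cost]
  simp only [MeasureTheory.measureReal_def, Real.volume_Ioo, sub_zero, ENNReal.ofReal_one,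
    ENNReal.toReal_one, inv_one, one_smul]
  refine Finset.sum_congr rfl fun R _ => ?_
  rw [MeasureTheory.integral_add (MeasureTheory.integrable_const α)
    (((hsub R).mul_const _).const_mul β), MeasureTheory.integral_const_mul,
    MeasureTheory.integral_mul_const, MeasureTheory.integral_sub
      (integral_snap F R.bottom_lt_top R.right).1 (integral_snap F R.bottom_lt_top R.left).1,
    (integral_snap F R.bottom_lt_top R.right).2, (integral_snap F R.bottom_lt_top R.left).2]
  simp [Rect.area]

/-- Points gained by moving a side outwards stay in the wide strip containing that side, and this
strip lies in the region at all heights of `R`. -/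
theorem snapRect_subset {R Q : Rect} (hR : R.toSet ⊆ unionOf F)
    (hQ : Q ∈ snapRect (unionOf F) t R) : Q.toSet ⊆ unionOf F := by
  obtain ⟨e1, e2, e3, e4⟩ := mem_snapRect.1 hQ
  have hbt := R.bottom_lt_top
  rintro ⟨x, y⟩ ⟨⟨h1, h2⟩, h3, h4⟩
  dsimp only at h1 h2 h3 h4
  rw [e1] at h1
  rw [e2] at h2
  rw [e3] at h3
  rw [e4] at h4
  have strip : ∀ S, IsWideStrip (unionOf F) R.bottom R.top S → S.left ≤ x → x ≤ S.right →
      (x, y) ∈ unionOf F := fun S hS hl hr =>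
    hS.1.toSet_subset ⟨⟨hl, hr⟩, hS.2.1.trans h3, h4.trans hS.2.2⟩
  rcases lt_or_ge x R.left with hl | hl
  · rcases snap_cases (F := F) hbt R.left with ⟨-, e⟩ | ⟨S, hS, hx, e⟩
    · rw [e] at h1
      exact absurd h1 (not_le.2 hl)
    · refine strip S hS ?_ (hl.trans hx.2).le
      rw [e] at h1
      split_ifs at h1
      · exact h1
      · exact S.left_lt_right.le.trans h1
  rcases lt_or_ge R.right x with hr | hr
  · rcases snap_cases (F := F) hbt R.right with ⟨-, e⟩ | ⟨S, hS, hx, e⟩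
    · rw [e] at h2
      exact absurd h2 (not_le.2 hr)
    · refine strip S hS (hx.1.trans hr).le ?_
      rw [e] at h2
      split_ifs at h2
      · exact h2.trans S.left_lt_right.le
      · exact h2
  exact hR ⟨⟨hl, hr⟩, h3, h4⟩

theorem isClosed_unionOf (F : Finset Rect) : IsClosed (unionOf F) := (isCompact_unionOf F).isClosed

/-- The snapped rectangles of a cover form a cover. -/
theorem unionOf_snapRect [DecidableEq Rect] (ht : t ∈ Ioo (0 : ℝ) 1) (C : Finset Rect) :
    unionOf (C.biUnion (snapRect (unionOf C) t)) = unionOf C := by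
  refine Subset.antisymm ?_ ?_
  · intro p hp
    obtain ⟨Q, hQ, hpQ⟩ := mem_unionOf.1 hp
    obtain ⟨R, hR, hQR⟩ := Finset.mem_biUnion.1 hQ
    exact snapRect_subset (toSet_subset_unionOf hR) hQR hpQ
  · refine (unionOf_subset_closure C (finite_xCoords C) (finite_yCoords C)).trans
      (closure_minimal ?_ (isClosed_unionOf _))
    rintro ⟨x, y⟩ ⟨hi, hx, hy⟩
    dsimp only at hx hy
    obtain ⟨S, hS, hxS, hyS⟩ :=
      exists_strip ⟨hi, fun h => hx (fst_mem_xCoords_of_mem_vrays h)⟩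
    dsimp only at hxS hyS
    have hlr := S.left_lt_right
    set θ := S.left + t * (S.right - S.left) with hθ
    have h1 : S.left < θ := by nlinarith [ht.1]
    have h2 : θ < S.right := by nlinarith [ht.2]
    -- Choose `u` just left of the threshold line, beyond every right side that lies left of that
    -- line. A rectangle over `u` then has its left side before `θ` and its right side at or after
    -- `θ`, so snapping spreads it across `S`.
    have hev : ∀ᶠ u in 𝓝[<] θ, ∀ R ∈ C, R.right < θ → R.right < u := by
      rw [eventually_all_finset]
      exact fun R _ => eventually_imp_distrib_left.2 fun h =>
        (lt_mem_nhds h).filter_mono nhdsWithin_le_nhds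
    have hev' : ∀ᶠ u in 𝓝[<] θ, S.left < u := (lt_mem_nhds h1).filter_mono nhdsWithin_le_nhds
    obtain ⟨u, hu, hu1, hu2⟩ := (hev.and (hev'.and self_mem_nhdsWithin)).exists
    replace hu2 : u < θ := hu2
    have huS : (u, y) ∈ S.openSet := ⟨⟨hu1, hu2.trans h2⟩, hyS⟩
    obtain ⟨R, hR, ⟨ha, hb⟩, hc, hd⟩ :=
      mem_unionOf.1 (hS.toSet_subset (S.openSet_subset_toSet huS))
    dsimp only at ha hb hc hd
    have hc' : R.bottom < y := lt_of_le_of_ne hc fun e =>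
      hy (mem_yCoords.2 ⟨R, hR, Or.inl e.symm⟩)
    have hd' : y < R.top := lt_of_le_of_ne hd fun e => hy (mem_yCoords.2 ⟨R, hR, Or.inr e⟩)
    have hw : IsWideStrip (unionOf C) R.bottom R.top S :=
      ⟨hS, hS.vertical_bounds (toSet_subset_unionOf hR) huS.1 hyS ⟨ha, hb⟩ ⟨hc', hd'⟩⟩
    have hr : θ ≤ R.right := by
      by_contra! h
      exact absurd (hu R hR h) (not_lt.2 hb)
    have k1 := snap_le hw R.bottom_lt_top ht (ha.trans_lt hu2)
    have k2 := le_snap hw R.bottom_lt_top ht hr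
    refine mem_unionOf.2 ⟨⟨_, _, R.bottom, R.top, k1.trans_lt (hlr.trans_le k2), R.bottom_lt_top⟩,
      Finset.mem_biUnion.2 ⟨R, hR, mem_snapRect.2 ⟨rfl, rfl, rfl, rfl⟩⟩, ⟨?_, ?_⟩, hc, hd⟩
    · exact k1.trans hxS.1.le
    · exact hxS.2.le.trans k2

/-! ### Aligned sides -/

/-- Inside the region, the vertical sides of `R` are covered by vertical rays. -/
def AlignedX (I : Set (ℝ × ℝ)) (R : Rect) : Prop :=
  ∀ y ∈ Ioo R.bottom R.top, ((R.left, y) ∈ interior I → (R.left, y) ∈ vrays I) ∧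
    ((R.right, y) ∈ interior I → (R.right, y) ∈ vrays I)

/-- Inside the region, the horizontal sides of `R` are covered by horizontal rays. -/
def AlignedY (I : Set (ℝ × ℝ)) (R : Rect) : Prop := AlignedX (Prod.swap ⁻¹' I) R.swap

/-- A moved side lies on the frontier of a strip, which avoids the cut interior. An unmoved side
meeting the cut interior would meet a strip, necessarily wide by `vertical_bounds`, and would have
been moved. -/
theorem snap_mem_vrays {R : Rect} (hR : R.toSet ⊆ unionOf F) {x y : ℝ}
    (hx : x ∈ Icc R.left R.right) (hy : y ∈ Ioo R.bottom R.top)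
    (h : (snap (unionOf F) R.bottom R.top t x, y) ∈ interior (unionOf F)) :
    (snap (unionOf F) R.bottom R.top t x, y) ∈ vrays (unionOf F) := by
  by_contra hv
  rcases snap_cases (F := F) R.bottom_lt_top x with ⟨hn, e⟩ | ⟨S, hS, -, e⟩
  · rw [e] at h hv
    obtain ⟨S, hS, hxS, hyS⟩ := exists_strip ⟨h, hv⟩
    exact hn ⟨S, ⟨hS, hS.vertical_bounds hR hxS hyS hx hy⟩, hxS⟩
  · have hyS : S.bottom < y ∧ y < S.top := ⟨hS.2.1.trans_lt hy.1, hy.2.trans_le hS.2.2⟩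
    refine hS.1.frontier_disjoint ⟨?_, hyS.1.le, hyS.2.le⟩ (fun ho => ?_) ⟨h, hv⟩
    · have := S.left_lt_right
      dsimp only
      rw [e]
      split_ifs
      exacts [⟨le_rfl, this.le⟩, ⟨this.le, le_rfl⟩]
    · have := ho.1
      dsimp only at this
      rw [e] at this
      split_ifs at this
      exacts [lt_irrefl _ this.1, lt_irrefl _ this.2]

theorem alignedX_of_mem_snapRect {R Q : Rect} (hR : R.toSet ⊆ unionOf F)
    (hQ : Q ∈ snapRect (unionOf F) t R) : AlignedX (unionOf F) Q := by
  obtain ⟨e1, e2, e3, e4⟩ := mem_snapRect.1 hQ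
  intro y hy
  rw [e3, e4] at hy
  rw [e1, e2]
  exact ⟨snap_mem_vrays hR ⟨le_rfl, R.left_lt_right.le⟩ hy,
    snap_mem_vrays hR ⟨R.left_lt_right.le, le_rfl⟩ hy⟩

/-- Points joined by a horizontal segment in the interior are reached by the same horizontal
rays. -/
theorem mem_hrays_of_segment {I : Set (ℝ × ℝ)} {x x' y : ℝ} (h : (x, y) ∈ hrays I)
    (hs : ∀ z ∈ uIcc x x', (z, y) ∈ interior I) : (x', y) ∈ hrays I := by
  refine mem_vrays_of_segment (y := x) h fun z hz => ?_
  rw [interior_swap_preimage]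
  exact hs z hz

theorem alignedY_iff {I : Set (ℝ × ℝ)} {R : Rect} : AlignedY I R ↔
    ∀ x ∈ Ioo R.left R.right, ((x, R.bottom) ∈ interior I → (x, R.bottom) ∈ hrays I) ∧
      ((x, R.top) ∈ interior I → (x, R.top) ∈ hrays I) := by
  simp only [AlignedY, AlignedX, interior_swap_preimage]
  rfl

/-- A horizontal side that is covered by rays remains so when it is extended inside a strip. -/
theorem mem_hrays_of_strip {S : Rect} (hS : IsStrip (unionOf F) S) {l r c : ℝ} (hlr : l < r)
    (h : ∀ x ∈ Ioo l r, (x, c) ∈ interior (unionOf F) → (x, c) ∈ hrays (unionOf F))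
    (hi : l < S.right) (hi' : S.left < r) (hc : c ∈ Icc S.bottom S.top) {x : ℝ}
    (hx : x ∈ Ioo S.left S.right) (hxi : (x, c) ∈ interior (unionOf F)) :
    (x, c) ∈ hrays (unionOf F) := by
  have hc' : c ∈ Ioo S.bottom S.top :=
    ⟨lt_of_le_of_ne hc.1 fun e => (hS.free x hx).bot (by rwa [e]),
      lt_of_le_of_ne hc.2 fun e => (hS.free x hx).top (by rwa [← e])⟩
  obtain ⟨u, hu1, hu2⟩ := exists_between (max_lt (lt_min hlr hi) (lt_min hi' S.left_lt_right))
  rw [max_lt_iff] at hu1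
  rw [lt_min_iff] at hu2
  refine mem_hrays_of_segment (h u ⟨hu1.1, hu2.1⟩
    ((hS.free u ⟨hu1.2, hu2.2⟩).mem c hc')) fun z hz => ?_
  refine (hS.free z ?_).mem c hc'
  rw [mem_uIcc] at hz
  rcases hz with hz | hz
  · exact ⟨hu1.2.trans_le hz.1, hz.2.trans_lt hx.2⟩
  · exact ⟨hx.1.trans_le hz.1, hz.2.trans_lt hu2.2⟩

/-- Horizontal sides are lengthened only within strips, where a horizontal ray continues
unobstructed. This is why one pass does not spoil the other. -/
theorem alignedY_of_mem_snapRect {R Q : Rect} (hY : AlignedY (unionOf F) R)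
    (hQ : Q ∈ snapRect (unionOf F) t R) : AlignedY (unionOf F) Q := by
  obtain ⟨e1, e2, e3, e4⟩ := mem_snapRect.1 hQ
  have hlr := R.left_lt_right
  have hbt := R.bottom_lt_top
  rw [alignedY_iff] at hY ⊢
  rw [e3, e4]
  have key : ∀ c ∈ Icc R.bottom R.top,
      (∀ x ∈ Ioo R.left R.right, (x, c) ∈ interior (unionOf F) → (x, c) ∈ hrays (unionOf F)) →
      ∀ x ∈ Ioo Q.left Q.right, (x, c) ∈ interior (unionOf F) → (x, c) ∈ hrays (unionOf F) := by
    intro c hc h x hx hxi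
    rcases le_or_gt x R.left with hl | hl
    · have h1 := hx.1
      rcases snap_cases (F := F) hbt R.left with ⟨-, e⟩ | ⟨S, hS, hxS, e⟩
      · rw [e1, e] at h1
        exact absurd h1 (not_lt.2 hl)
      · refine mem_hrays_of_strip hS.1 hlr h hxS.2 (hxS.1.trans hlr)
          ⟨hS.2.1.trans hc.1, hc.2.trans hS.2.2⟩ ⟨?_, hl.trans_lt hxS.2⟩ hxi
        rw [e1, e] at h1
        split_ifs at h1
        · exact h1
        · exact S.left_lt_right.trans h1
    rcases le_or_gt R.right x with hr | hr
    · have h2 := hx.2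
      rcases snap_cases (F := F) hbt R.right with ⟨-, e⟩ | ⟨S, hS, hxS, e⟩
      · rw [e2, e] at h2
        exact absurd h2 (not_lt.2 hr)
      · refine mem_hrays_of_strip hS.1 hlr h (hlr.trans hxS.2) hxS.1
          ⟨hS.2.1.trans hc.1, hc.2.trans hS.2.2⟩ ⟨hxS.1.trans_le hr, ?_⟩ hxi
        rw [e2, e] at h2
        split_ifs at h2
        · exact h2.trans S.left_lt_right
        · exact h2
    exact h x ⟨hl, hr⟩ hxi
  exact fun x hx => ⟨key _ ⟨le_rfl, hbt.le⟩ (fun u hu => (hY u hu).1) x hx,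
    key _ ⟨hbt.le, le_rfl⟩ (fun u hu => (hY u hu).2) x hx⟩

/-- A cover can be replaced by a cover of no larger cost with aligned vertical sides; alignment of
the horizontal sides is kept. -/
theorem exists_alignedX_cover {α β : ℝ} (hα : 0 ≤ α) (hβ : 0 ≤ β) (C : Finset Rect) :
    ∃ C' : Finset Rect, unionOf C' = unionOf C ∧ cost α β C' ≤ cost α β C ∧
      (∀ R ∈ C', AlignedX (unionOf C) R) ∧
      ((∀ R ∈ C, AlignedY (unionOf C) R) → ∀ R ∈ C', AlignedY (unionOf C) R) := by
  classical
  obtain ⟨t, ht, hcost⟩ := exists_threshold (F := C) α β C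
  refine ⟨C.biUnion (snapRect (unionOf C) t), unionOf_snapRect ht C, ?_, ?_, ?_⟩
  · exact ((cost_biUnion_le hα hβ _ _).trans
      (Finset.sum_le_sum fun R _ => cost_snapRect_le ht hα β R)).trans hcost
  · intro Q hQ
    obtain ⟨R, hR, hQR⟩ := Finset.mem_biUnion.1 hQ
    exact alignedX_of_mem_snapRect (toSet_subset_unionOf hR) hQR
  · intro h Q hQ
    obtain ⟨R, hR, hQR⟩ := Finset.mem_biUnion.1 hQ
    exact alignedY_of_mem_snapRect (h R hR) hQR

/-- A cover can be replaced by a cover of no larger cost with aligned sides. -/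
theorem exists_aligned_cover {α β : ℝ} (hα : 0 ≤ α) (hβ : 0 ≤ β) (C : Finset Rect) :
    ∃ C' : Finset Rect, unionOf C' = unionOf C ∧ cost α β C' ≤ cost α β C ∧
      ∀ R ∈ C', AlignedX (unionOf C) R ∧ AlignedY (unionOf C) R := by
  obtain ⟨C₁, h1, h2, h3, -⟩ := exists_alignedX_cover hα hβ C
  -- The second pass runs on the reflected cover, where the alignment already gained is that of the
  -- horizontal sides and is kept by `k4`.
  obtain ⟨C₂, k1, k2, k3, k4⟩ := exists_alignedX_cover hα hβ (swapAll C₁)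
  have hI : unionOf (swapAll C₁) = Prod.swap ⁻¹' unionOf C := by rw [unionOf_swapAll, h1]
  have hII : Prod.swap ⁻¹' (Prod.swap ⁻¹' unionOf C) = unionOf C := rfl
  rw [hI] at k1 k3 k4
  refine ⟨swapAll C₂, by rw [unionOf_swapAll, k1, hII], ?_, fun R hR => ?_⟩
  · rw [cost_swapAll]
    rw [cost_swapAll] at k2
    exact k2.trans h2
  · rw [mem_swapAll] at hR
    refine ⟨?_, k3 _ hR⟩
    exact k4 (fun Q hQ => h3 _ (mem_swapAll.1 hQ)) _ hR

/-! ### Base rectangles -/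

/-- The components of the interior cut along all rays are open rectangles. -/
theorem exists_component {p : ℝ × ℝ}
    (h : p ∈ interior (unionOf F) \ (vrays (unionOf F) ∪ hrays (unionOf F))) :
    ∃ Q : Rect, (Q.left ∈ xCoords F ∧ Q.right ∈ xCoords F ∧ Q.bottom ∈ yCoords F ∧
      Q.top ∈ yCoords F) ∧ p ∈ Q.openSet ∧
      connectedComponentIn (interior (unionOf F) \ (vrays (unionOf F) ∪ hrays (unionOf F))) p =
        Q.openSet := by
  set D := connectedComponentIn (interior (unionOf F) \ (vrays (unionOf F) ∪ hrays (unionOf F))) p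
    with hD
  have hpD : p ∈ D := mem_connectedComponentIn h
  have hDsub : D ⊆ interior (unionOf F) \ (vrays (unionOf F) ∪ hrays (unionOf F)) :=
    connectedComponentIn_subset _ _
  have hDc : IsPreconnected D := isPreconnected_connectedComponentIn
  obtain ⟨S, hS, hpS⟩ := exists_strip ⟨h.1, fun hv => h.2 (Or.inl hv)⟩
  have hp' : p.swap ∈ interior (unionOf (swapAll F)) \ vrays (unionOf (swapAll F)) := by
    rw [unionOf_swapAll, interior_swap_preimage]
    exact ⟨h.1, fun hv => h.2 (Or.inr hv)⟩
  obtain ⟨T, hT, hpT⟩ := exists_strip hp'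
  obtain ⟨c1, c2, c3, c4⟩ := hS.coords
  obtain ⟨d1, d2, d3, d4⟩ := hT.coords
  rw [yCoords, swapAll_swapAll] at d3 d4
  have hDS : D ⊆ S.openSet := hS.subset_openSet hDc
    (fun q hq => ⟨(hDsub hq).1, fun hv => (hDsub hq).2 (Or.inl hv)⟩) ⟨p, hpD, hpS⟩
  have hDT : Prod.swap '' D ⊆ T.openSet := by
    refine hT.subset_openSet (hDc.image _ continuous_swap.continuousOn) ?_
      ⟨p.swap, mem_image_of_mem _ hpD, hpT⟩
    rintro _ ⟨q, hq, rfl⟩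
    rw [unionOf_swapAll, interior_swap_preimage]
    exact ⟨(hDsub hq).1, fun hv => (hDsub hq).2 (Or.inr hv)⟩
  obtain ⟨⟨s1, s2⟩, s3, s4⟩ := hpS
  obtain ⟨⟨t1, t2⟩, t3, t4⟩ := hpT
  simp only [Prod.fst_swap, Prod.snd_swap] at t1 t2 t3 t4
  -- The component is the intersection of the vertical strip `S` with the reflection of `T`, the
  -- strip of the reflected region.
  let Q : Rect := ⟨max S.left T.bottom, min S.right T.top, max S.bottom T.left, min S.top T.right,
    (max_lt s1 t3).trans (lt_min s2 t4), (max_lt s3 t1).trans (lt_min s4 t2)⟩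
  have hQ : ∀ q, q ∈ Q.openSet ↔ q ∈ S.openSet ∧ q.swap ∈ T.openSet := by
    intro q
    simp only [Rect.mem_openSet, Q, max_lt_iff, lt_min_iff, Prod.fst_swap, Prod.snd_swap]
    tauto
  have hpQ : p ∈ Q.openSet := (hQ p).2 ⟨⟨⟨s1, s2⟩, s3, s4⟩, ⟨⟨t1, t2⟩, t3, t4⟩⟩
  refine ⟨Q, ⟨?_, ?_, ?_, ?_⟩, hpQ, Subset.antisymm
    (fun q hq => (hQ q).2 ⟨hDS hq, hDT (mem_image_of_mem _ hq)⟩)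
    (Q.isPreconnected_openSet.subset_connectedComponentIn hpQ fun q hq => ?_)⟩
  · exact max_rec' (· ∈ xCoords F) c1 d3
  · exact min_rec' (· ∈ xCoords F) c2 d4
  · exact max_rec' (· ∈ yCoords F) c3 d1
  · exact min_rec' (· ∈ yCoords F) c4 d2
  · obtain ⟨h1, h2⟩ := (hQ q).1 hq
    have k1 := hS.openSet_subset h1
    have k2 := hT.openSet_subset h2
    rw [unionOf_swapAll, interior_swap_preimage] at k2
    exact ⟨k1.1, fun hv => hv.elim k1.2 k2.2⟩

/-- A corner of an aligned rectangle that lies in the interior is reached by a vertical ray. -/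
theorem AlignedX.corner {I : Set (ℝ × ℝ)} {R : Rect} (h : AlignedX I R) {x c : ℝ}
    (hx : x = R.left ∨ x = R.right) (hc : c = R.bottom ∨ c = R.top)
    (hi : (x, c) ∈ interior I) : (x, c) ∈ vrays I := by
  have hbt := R.bottom_lt_top
  obtain ⟨ε, hε, H⟩ := Metric.isOpen_iff.1 isOpen_interior _ hi
  obtain ⟨y, hy, hyc⟩ : ∃ y ∈ Ioo R.bottom R.top, |y - c| < ε := by
    rcases hc with rfl | rfl
    · obtain ⟨y, h1, h2⟩ := exists_between (lt_min hbt (lt_add_of_pos_right R.bottom hε))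
      rw [lt_min_iff] at h2
      exact ⟨y, ⟨h1, h2.1⟩, abs_lt.2 ⟨by linarith, by linarith⟩⟩
    · obtain ⟨y, h1, h2⟩ := exists_between (max_lt hbt (sub_lt_self R.top hε))
      rw [max_lt_iff] at h1
      exact ⟨y, ⟨h1.1, h2⟩, abs_lt.2 ⟨by linarith, by linarith⟩⟩
  have hseg : ∀ z ∈ uIcc y c, (x, z) ∈ interior I := by
    intro z hz
    refine H ?_
    rw [Metric.mem_ball, Prod.dist_eq, dist_self, Real.dist_eq]
    refine max_lt hε ((abs_sub_le_iff.2 ?_).trans_lt hyc)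
    rw [mem_uIcc] at hz
    rcases hz with hz | hz
    · rw [abs_of_nonpos (by linarith)]
      constructor <;> linarith
    · rw [abs_of_nonneg (by linarith)]
      constructor <;> linarith
  have hyv : (x, y) ∈ vrays I := by
    rcases hx with rfl | rfl
    · exact (h y hy).1 (hseg y left_mem_uIcc)
    · exact (h y hy).2 (hseg y left_mem_uIcc)
  exact mem_vrays_of_segment hyv hseg

theorem mem_rays_of_aligned {I : Set (ℝ × ℝ)} {R : Rect} (hX : AlignedX I R) (hY : AlignedY I R)
    {p : ℝ × ℝ} (hp : p ∈ R.toSet) (hpo : p ∉ R.openSet) (hi : p ∈ interior I) :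
    p ∈ vrays I ∪ hrays I := by
  obtain ⟨x, y⟩ := p
  rw [alignedY_iff] at hY
  have hx : x ∈ Ioo R.left R.right ∨ x = R.left ∨ x = R.right := by
    have := hp.1
    simp only [mem_Icc, mem_Ioo] at this ⊢
    grind
  have hy : y ∈ Ioo R.bottom R.top ∨ y = R.bottom ∨ y = R.top := by
    have := hp.2
    simp only [mem_Icc, mem_Ioo] at this ⊢
    grind
  rcases hx with hx | hx
  · rcases hy with hy | rfl | rfl
    · exact absurd ⟨hx, hy⟩ hpo
    · exact Or.inr ((hY x hx).1 hi)
    · exact Or.inr ((hY x hx).2 hi)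
  · rcases hy with hy | hy
    · rcases hx with rfl | rfl
      · exact Or.inl ((hX y hy).1 hi)
      · exact Or.inl ((hX y hy).2 hi)
    · exact Or.inl (hX.corner hx hy hi)

theorem baseRects_finite {P : Polygon} (hP : P.region = unionOf F)
    (hrays : P.rays = vrays (unionOf F) ∪ hrays (unionOf F)) : (baseRects P).Finite := by
  refine (Rect.finite_of_coords (finite_xCoords F) (finite_yCoords F)).subset ?_
  rintro R ⟨p, hp, hR⟩
  rw [hP, hrays] at hp hR
  obtain ⟨Q, hQ, -, hQ'⟩ := exists_component hp
  rw [Rect.openSet_injective (hR.symm.trans hQ')]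
  exact hQ

/-- The frontier of an aligned `R` misses the interior cut along all rays, so a component meeting
the open rectangle stays inside it. These components contain a dense part of `R`, and finitely many
closed base rectangles have a closed union. -/
theorem mem_rectPowerset_of_aligned {P : Polygon} (hP : P.region = unionOf F)
    (hrays : P.rays = vrays (unionOf F) ∪ hrays (unionOf F)) {R : Rect} (hR : R.toSet ⊆ unionOf F)
    (hX : AlignedX (unionOf F) R) (hY : AlignedY (unionOf F) R) :
    R ∈ rectPowerset (baseRects P) := by
  refine ⟨{Q ∈ baseRects P | Q.toSet ⊆ R.toSet}, fun Q hQ => hQ.1, Subset.antisymm ?_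
    (iUnion₂_subset fun Q hQ => hQ.2)⟩
  have hfin : {Q ∈ baseRects P | Q.toSet ⊆ R.toSet}.Finite :=
    (baseRects_finite hP hrays).subset fun Q hQ => hQ.1
  have hcl : IsClosed (⋃ Q ∈ {Q ∈ baseRects P | Q.toSet ⊆ R.toSet}, Q.toSet) :=
    hfin.isClosed_biUnion fun Q _ => Q.isClosed_toSet
  refine R.closure_openSet.symm.subset.trans (closure_minimal (((dense_compl_prod_compl (finite_xCoords F)
    (finite_yCoords F)).open_subset_closure_inter R.isOpen_openSet).trans
    (closure_minimal ?_ hcl)) hcl)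
  rintro p ⟨hpR, hpx, hpy⟩
  have hp : p ∈ interior (unionOf F) \ (vrays (unionOf F) ∪ RectCover.hrays (unionOf F)) :=
    ⟨R.openSet_subset_interior hR hpR, fun h => h.elim
      (fun h => hpx (fst_mem_xCoords_of_mem_vrays h))
      (fun h => hpy (snd_mem_yCoords_of_mem_hrays h))⟩
  obtain ⟨Q, -, hpQ, hQ⟩ := exists_component hp
  have hQB : Q ∈ baseRects P := ⟨p, by rwa [hP, hrays], by rw [hP, hrays, hQ]⟩
  have hQR : Q.openSet ⊆ R.openSet := by
    refine Q.isPreconnected_openSet.subset_left_of_subset_union R.isOpen_openSet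
      R.isClosed_toSet.isOpen_compl (disjoint_compl_right.mono_left R.openSet_subset_toSet)
      (fun q hq => ?_) ⟨p, hpQ, hpR⟩
    have hq' := connectedComponentIn_subset _ _ (hQ.symm ▸ hq)
    by_cases hqo : q ∈ R.openSet
    · exact Or.inl hqo
    · exact Or.inr fun hqR => hq'.2 (mem_rays_of_aligned hX hY hqR hqo hq'.1)
  refine mem_biUnion (x := Q) ⟨hQB, ?_⟩ (Q.openSet_subset_toSet hpQ)
  rw [← R.closure_openSet, ← Q.closure_openSet]
  exact closure_mono hQR

/-! ### Existence of an optimal cover -/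

theorem finite_rectPowerset {B : Set Rect} (hB : B.Finite) : (rectPowerset B).Finite := by
  refine Finite.of_finite_image (f := Rect.toSet) (((hB.finite_subsets).image
    fun S => ⋃ Q ∈ S, Q.toSet).subset ?_) Rect.toSet_injective.injOn
  rintro _ ⟨R, ⟨S, hS, hR⟩, rfl⟩
  exact ⟨S, hS, hR.symm⟩

theorem isCover_iff {P : Polygon} {C : Finset Rect} : IsCover P C ↔ P.region = unionOf C :=
  ⟨fun h => h.2, fun h => ⟨fun _ hR => h ▸ toSet_subset_unionOf hR, h⟩⟩

/-- The theorem for a polygon whose region is a finite union of rectangles and all of whose concave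
corners are vertices. -/
theorem exists_optimal_cover {P : Polygon} (hP : P.region = unionOf F)
    (hr : P.rays = vrays P.region ∪ hrays P.region) {α β : ℝ} (hα : 0 ≤ α) (hβ : 0 ≤ β) :
    ∃ C : Finset Rect, IsOptimalCover P α β C ∧ (C : Set Rect) ⊆ rectPowerset (baseRects P) := by
  have key : ∀ C, IsCover P C → ∃ C', (IsCover P C' ∧
      (C' : Set Rect) ⊆ rectPowerset (baseRects P)) ∧ cost α β C' ≤ cost α β C := by
    intro C hC
    rw [isCover_iff] at hC
    obtain ⟨C', h1, h2, h3⟩ := exists_aligned_cover hα hβ C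
    refine ⟨C', ⟨isCover_iff.2 (hC.trans h1.symm), fun R hR => ?_⟩, h2⟩
    exact mem_rectPowerset_of_aligned hC (hC ▸ hr)
      ((toSet_subset_unionOf hR).trans h1.subset) (h3 R hR).1 (h3 R hR).2
  have hfin : {C : Finset Rect | IsCover P C ∧
      (C : Set Rect) ⊆ rectPowerset (baseRects P)}.Finite := by
    have hG := finite_rectPowerset (baseRects_finite hP (hP ▸ hr))
    refine Finite.of_finite_image (f := fun C : Finset Rect => (C : Set Rect))
      (hG.finite_subsets.subset ?_) Finset.coe_injective.injOn
    rintro _ ⟨C, hC, rfl⟩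
    exact hC.2
  -- The region is itself given as a finite union of rectangles, so a cover exists and the minimum
  -- is over a nonempty set.
  obtain ⟨C₀, hC₀, -⟩ := key F (isCover_iff.2 hP)
  obtain ⟨C, hC, hmin⟩ := exists_min_image _ (cost α β) hfin ⟨C₀, hC₀⟩
  refine ⟨C, ⟨hC.1, fun C' hC' => ?_⟩, hC.2⟩
  obtain ⟨C'', h1, h2⟩ := key C' hC'
  exact (hmin C'' h1).trans h2

/-! ### Simple polygons -/

namespace SimplePolygon

variable (K : SimplePolygon)

instance : NeZero K.size := ⟨K.size_pos.ne'⟩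

theorem finite_range_vert : (range K.vert).Finite := finite_range _

theorem edge_subset_boundary (i : ZMod K.size) :
    segment ℝ (K.vert i) (K.vert (i + 1)) ⊆ K.boundary :=
  subset_iUnion (fun i => segment ℝ (K.vert i) (K.vert (i + 1))) i

theorem isClosed_edge (i : ZMod K.size) : IsClosed (segment ℝ (K.vert i) (K.vert (i + 1))) := by
  rw [segment_eq_image_lineMap]
  exact (isCompact_Icc.image (by fun_prop)).isClosed

theorem isClosed_boundary : IsClosed K.boundary :=
  isClosed_iUnion_of_finite K.isClosed_edge

theorem mem_uIcc_of_mem_segment {a b p : ℝ × ℝ} (h : p ∈ segment ℝ a b) :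
    p.1 ∈ uIcc a.1 b.1 ∧ p.2 ∈ uIcc a.2 b.2 := by
  have := Prod.segment_subset _ _ h
  rwa [segment_eq_uIcc, segment_eq_uIcc] at this

/-- Every edge is horizontal or vertical. -/
theorem edge_axis (i : ZMod K.size) :
    ((K.vert i).2 = (K.vert (i + 1)).2 ∧
      ∀ p ∈ segment ℝ (K.vert i) (K.vert (i + 1)), p.2 = (K.vert i).2) ∨
    ((K.vert i).1 = (K.vert (i + 1)).1 ∧
      ∀ p ∈ segment ℝ (K.vert i) (K.vert (i + 1)), p.1 = (K.vert i).1) := by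
  rcases K.alternating i with ⟨h, -⟩ | ⟨h, -⟩
  · refine Or.inl ⟨h, fun p hp => ?_⟩
    simpa [← h] using (mem_uIcc_of_mem_segment hp).2
  · refine Or.inr ⟨h, fun p hp => ?_⟩
    simpa [← h] using (mem_uIcc_of_mem_segment hp).1

/-- Consecutive edges are perpendicular, so they share a single point. -/
theorem eq_vert_of_mem_adjacent {i : ZMod K.size} {p : ℝ × ℝ}
    (h : p ∈ segment ℝ (K.vert i) (K.vert (i + 1)))
    (h' : p ∈ segment ℝ (K.vert (i + 1)) (K.vert (i + 1 + 1))) : p = K.vert (i + 1) := by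
  have h1 := mem_uIcc_of_mem_segment h
  have h2 := mem_uIcc_of_mem_segment h'
  rcases K.alternating i with ⟨e, e'⟩ | ⟨e, e'⟩
  · rw [e, uIcc_self] at h1
    rw [← e', uIcc_self] at h2
    exact Prod.ext h2.1 h1.2
  · rw [e, uIcc_self] at h1
    rw [← e', uIcc_self] at h2
    exact Prod.ext h1.1 h2.2

/-- At a point of an edge that is not a vertex, the boundary is locally a line. -/
theorem eventually_mem_edge {v : ℝ × ℝ} (hv : v ∉ range K.vert) {i : ZMod K.size}
    (hi : v ∈ segment ℝ (K.vert i) (K.vert (i + 1))) :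
    ∀ᶠ p in 𝓝 v, p ∈ K.boundary → p ∈ segment ℝ (K.vert i) (K.vert (i + 1)) := by
  have : ∀ᶠ p in 𝓝 v, ∀ j, j ≠ i → p ∉ segment ℝ (K.vert j) (K.vert (j + 1)) := by
    rw [eventually_all]
    refine fun j => eventually_imp_distrib_left.2 fun hj => (K.isClosed_edge j).isOpen_compl.mem_nhds
      fun hvj => ?_
    by_cases h1 : j = i + 1
    · subst h1
      exact hv ⟨_, (K.eq_vert_of_mem_adjacent hi hvj).symm⟩
    by_cases h2 : i = j + 1
    · subst h2
      exact hv ⟨_, (K.eq_vert_of_mem_adjacent hvj hi).symm⟩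
    exact (K.simple i j hj.symm h1 h2).le_bot ⟨hi, hvj⟩
  filter_upwards [this] with p hp hpb
  obtain ⟨j, hj⟩ := mem_iUnion.1 hpb
  by_contra h
  exact hp j (fun e => h (e ▸ hj)) hj

/-- A horizontal coordinate and a vertical one, in either order. -/
def IsAxisPair (f g : ℝ × ℝ →ₗ[ℝ] ℝ) : Prop :=
  (f = LinearMap.fst ℝ ℝ ℝ ∧ g = LinearMap.snd ℝ ℝ ℝ) ∨
    (f = LinearMap.snd ℝ ℝ ℝ ∧ g = LinearMap.fst ℝ ℝ ℝ)

/-- The points `a`, `b` are the ends of the edge through `v`. They serve the case in which an edge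
of a hole crosses an edge of the outer polygon. -/
theorem exists_line {v : ℝ × ℝ} (hb : v ∈ K.boundary) (hv : v ∉ range K.vert) :
    ∃ f g, IsAxisPair f g ∧ (∀ᶠ p in 𝓝 v, p ∈ K.boundary → f p = f v) ∧
      ∃ a b, g a < g v ∧ g v < g b ∧ segment ℝ v a ⊆ K.boundary ∧ segment ℝ v b ⊆ K.boundary := by
  obtain ⟨i, hi⟩ := mem_iUnion.1 hb
  have hloc := K.eventually_mem_edge hv hi
  have hsub : ∀ w ∈ segment ℝ (K.vert i) (K.vert (i + 1)), segment ℝ v w ⊆ K.boundary :=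
    fun w hw => ((convex_segment _ _).segment_subset hi hw).trans (K.edge_subset_boundary i)
  have hs1 := hsub _ (left_mem_segment _ _ _)
  have hs2 := hsub _ (right_mem_segment _ _ _)
  have hv1 : v ≠ K.vert i := fun e => hv ⟨_, e.symm⟩
  have hv2 : v ≠ K.vert (i + 1) := fun e => hv ⟨_, e.symm⟩
  have hmem := mem_uIcc_of_mem_segment hi
  have aux : ∀ {x y z : ℝ}, z ∈ uIcc x y → z ≠ x → z ≠ y → (x < z ∧ z < y) ∨ (y < z ∧ z < x) := by
    intro x y z hz h1 h2
    rw [mem_uIcc] at hz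
    grind
  rcases K.edge_axis i with ⟨he, hline⟩ | ⟨he, hline⟩
  · refine ⟨LinearMap.snd ℝ ℝ ℝ, LinearMap.fst ℝ ℝ ℝ, Or.inr ⟨rfl, rfl⟩, ?_, ?_⟩
    · filter_upwards [hloc] with p hp hpb
      exact (hline p (hp hpb)).trans (hline v hi).symm
    · have hv2' := hline v hi
      rcases aux hmem.1 (fun e => hv1 (Prod.ext e hv2'))
        (fun e => hv2 (Prod.ext e (hv2'.trans he))) with h | h
      · exact ⟨_, _, h.1, h.2, hs1, hs2⟩
      · exact ⟨_, _, h.1, h.2, hs2, hs1⟩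
  · refine ⟨LinearMap.fst ℝ ℝ ℝ, LinearMap.snd ℝ ℝ ℝ, Or.inl ⟨rfl, rfl⟩, ?_, ?_⟩
    · filter_upwards [hloc] with p hp hpb
      exact (hline p (hp hpb)).trans (hline v hi).symm
    · have hv2' := hline v hi
      rcases aux hmem.2 (fun e => hv1 (Prod.ext hv2' e))
        (fun e => hv2 (Prod.ext (hv2'.trans he) e)) with h | h
      · exact ⟨_, _, h.1, h.2, hs1, hs2⟩
      · exact ⟨_, _, h.1, h.2, hs2, hs1⟩

theorem mem_enclosed_of_isPreconnected {D : Set (ℝ × ℝ)} (hD : IsPreconnected D)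
    (hd : D ⊆ K.boundaryᶜ) {p q : ℝ × ℝ} (hp : p ∈ D) (hq : q ∈ D) (h : p ∈ K.enclosed) :
    q ∈ K.enclosed := by
  have := connectedComponentIn_eq (hD.subset_connectedComponentIn hp hd hq)
  exact ⟨hd hq, this ▸ h.2⟩

theorem mem_closedRegion_of_isPreconnected {D : Set (ℝ × ℝ)} (hD : IsPreconnected D)
    (hd : D ⊆ K.boundaryᶜ) {p q : ℝ × ℝ} (hp : p ∈ D) (hq : q ∈ D) (h : p ∈ K.closedRegion) :
    q ∈ K.closedRegion :=
  Or.inr (K.mem_enclosed_of_isPreconnected hD hd hp hq (h.resolve_left (hd hp)))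

theorem exists_ball_subset {v : ℝ × ℝ} (hv : v ∉ K.boundary) :
    ∃ ε > 0, Metric.ball v ε ⊆ K.boundaryᶜ :=
  Metric.isOpen_iff.1 K.isClosed_boundary.isOpen_compl v hv

theorem isOpen_enclosed : IsOpen K.enclosed := by
  rw [Metric.isOpen_iff]
  intro v hv
  obtain ⟨ε, hε, h⟩ := K.exists_ball_subset hv.1
  exact ⟨ε, hε, fun p hp => K.mem_enclosed_of_isPreconnected (convex_ball v ε).isPreconnected h
    (Metric.mem_ball_self hε) hp hv⟩

theorem isClosed_closedRegion : IsClosed K.closedRegion := by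
  rw [← isOpen_compl_iff, Metric.isOpen_iff]
  intro v hv
  obtain ⟨ε, hε, h⟩ := K.exists_ball_subset fun h => hv (Or.inl h)
  exact ⟨ε, hε, fun p hp hpK => hv (K.mem_closedRegion_of_isPreconnected
    (convex_ball v ε).isPreconnected h hp (Metric.mem_ball_self hε) hpK)⟩

/-- A ray from an enclosed point meets the boundary. -/
theorem exists_mem_boundary_of_ray {p u : ℝ × ℝ} (hp : p ∈ K.enclosed) (hu : u ≠ 0) :
    ∃ s : ℝ, 0 ≤ s ∧ p + s • u ∈ K.boundary := by
  by_contra! h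
  have hpre : IsPreconnected ((fun s : ℝ => p + s • u) '' Ici 0) :=
    isPreconnected_Ici.image _ (by fun_prop)
  have hsub : (fun s : ℝ => p + s • u) '' Ici 0 ⊆ connectedComponentIn K.boundaryᶜ p := by
    refine hpre.subset_connectedComponentIn ⟨0, self_mem_Ici, by simp⟩ ?_
    rintro _ ⟨s, hs, rfl⟩
    exact h s hs
  obtain ⟨M, hM⟩ := (hp.2.subset hsub).exists_norm_le
  have hu' : 0 < ‖u‖ := norm_pos_iff.2 hu
  have hM0 : 0 ≤ M := (norm_nonneg _).trans (hM _ (mem_image_of_mem _ self_mem_Ici))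
  have h1 := hM _ (mem_image_of_mem _
    (mem_Ici.2 (by positivity : 0 ≤ (M + ‖p‖ + 1) / ‖u‖)))
  have h2 : ‖((M + ‖p‖ + 1) / ‖u‖) • u‖ = M + ‖p‖ + 1 := by
    rw [norm_smul, Real.norm_of_nonneg (by positivity), div_mul_cancel₀ _ hu'.ne']
  have h3 := norm_sub_le (p + ((M + ‖p‖ + 1) / ‖u‖) • u) p
  rw [add_sub_cancel_left, h2] at h3
  linarith

/-- An enclosed point has vertices on both sides in either coordinate. -/
theorem exists_vert_bounds {p : ℝ × ℝ} (hp : p ∈ K.enclosed) :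
    (∃ i, (K.vert i).1 ≤ p.1) ∧ (∃ i, p.1 ≤ (K.vert i).1) ∧
      (∃ i, (K.vert i).2 ≤ p.2) ∧ ∃ i, p.2 ≤ (K.vert i).2 := by
  -- A ray in each axis direction hits an edge, and one of the ends of that edge lies at least as
  -- far in that direction.
  have key : ∀ u : ℝ × ℝ, u ≠ 0 → ∃ s : ℝ, 0 ≤ s ∧ ∃ i,
      p.1 + s * u.1 ∈ uIcc (K.vert i).1 (K.vert (i + 1)).1 ∧
      p.2 + s * u.2 ∈ uIcc (K.vert i).2 (K.vert (i + 1)).2 := by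
    intro u hu
    obtain ⟨s, hs, h⟩ := K.exists_mem_boundary_of_ray hp hu
    obtain ⟨i, hi⟩ := mem_iUnion.1 h
    exact ⟨s, hs, i, mem_uIcc_of_mem_segment hi⟩
  have lo : ∀ {x a b : ℝ}, x ∈ uIcc a b → a ≤ x ∨ b ≤ x := fun h => by
    rw [mem_uIcc] at h
    tauto
  have hi : ∀ {x a b : ℝ}, x ∈ uIcc a b → x ≤ a ∨ x ≤ b := fun h => by
    rw [mem_uIcc] at h
    tauto
  refine ⟨?_, ?_, ?_, ?_⟩
  · obtain ⟨s, hs, i, h, -⟩ := key (-1, 0) (by simp)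
    rcases lo h with h | h <;> exact ⟨_, by dsimp only at h; linarith⟩
  · obtain ⟨s, hs, i, h, -⟩ := key (1, 0) (by simp)
    rcases hi h with h | h <;> exact ⟨_, by dsimp only at h; linarith⟩
  · obtain ⟨s, hs, i, -, h⟩ := key (0, -1) (by simp)
    rcases lo h with h | h <;> exact ⟨_, by dsimp only at h; linarith⟩
  · obtain ⟨s, hs, i, -, h⟩ := key (0, 1) (by simp)
    rcases hi h with h | h <;> exact ⟨_, by dsimp only at h; linarith⟩

/-- Off the coordinate lines through the vertices there is no boundary. -/
theorem notMem_boundary {p : ℝ × ℝ} (h1 : ∀ i, (K.vert i).1 ≠ p.1) (h2 : ∀ i, (K.vert i).2 ≠ p.2) :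
    p ∉ K.boundary := by
  intro h
  obtain ⟨i, hi⟩ := mem_iUnion.1 h
  rcases K.edge_axis i with ⟨-, he⟩ | ⟨-, he⟩
  · exact h2 i (he p hi).symm
  · exact h1 i (he p hi).symm

end SimplePolygon

/-! ### Local constancy on the sides of an axis-parallel line -/

/-- Near `v` and off the axis-parallel lines through `v`, membership in `D` depends only on the side
of the line `f = f v`. -/
def SideConst (f : ℝ × ℝ →ₗ[ℝ] ℝ) (v : ℝ × ℝ) (D : Set (ℝ × ℝ)) : Prop :=
  ∀ᶠ r in 𝓝 v ×ˢ 𝓝 v, (r.1.1 ≠ v.1 ∧ r.1.2 ≠ v.2) → (r.2.1 ≠ v.1 ∧ r.2.2 ≠ v.2) →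
    0 < (f r.1 - f v) * (f r.2 - f v) → r.1 ∈ D → r.2 ∈ D

theorem sideConst_of_notMem {f : ℝ × ℝ →ₗ[ℝ] ℝ} {v : ℝ × ℝ} {D : Set (ℝ × ℝ)} (hD : IsClosed D)
    (hv : v ∉ D) : SideConst f v D := by
  have : ∀ᶠ r in 𝓝 v ×ˢ 𝓝 v, r.1 ∉ D :=
    tendsto_fst.eventually (hD.isOpen_compl.mem_nhds hv)
  filter_upwards [this] with r hr _ _ _ h
  exact absurd h hr

namespace SimplePolygon

variable (K : SimplePolygon) {v : ℝ × ℝ} {f : ℝ × ℝ →ₗ[ℝ] ℝ}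

/-- Near `v`, points on the same side of the line can be joined off the boundary. -/
theorem eventually_exists_preconnected (h : ∀ᶠ p in 𝓝 v, p ∈ K.boundary → f p = f v) :
    ∀ᶠ r in 𝓝 v ×ˢ 𝓝 v, 0 < (f r.1 - f v) * (f r.2 - f v) →
      ∃ D, IsPreconnected D ∧ D ⊆ K.boundaryᶜ ∧ r.1 ∈ D ∧ r.2 ∈ D := by
  obtain ⟨ε, hε, H⟩ := Metric.eventually_nhds_iff_ball.1 h
  have hb := Metric.ball_mem_nhds v hε
  filter_upwards [prod_mem_prod hb hb] with r hr hs
  rcases pos_and_pos_or_neg_and_neg_of_mul_pos hs with ⟨h1, h2⟩ | ⟨h1, h2⟩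
  · refine ⟨Metric.ball v ε ∩ {p | f v < f p}, ((convex_ball v ε).inter
      (convex_halfSpace_gt f.isLinear _)).isPreconnected, fun p hp hpb => ?_,
      ⟨hr.1, sub_pos.1 h1⟩, hr.2, sub_pos.1 h2⟩
    exact absurd (H p hp.1 hpb) (ne_of_gt hp.2)
  · refine ⟨Metric.ball v ε ∩ {p | f p < f v}, ((convex_ball v ε).inter
      (convex_halfSpace_lt f.isLinear _)).isPreconnected, fun p hp hpb => ?_,
      ⟨hr.1, sub_neg.1 h1⟩, hr.2, sub_neg.1 h2⟩
    exact absurd (H p hp.1 hpb) (ne_of_lt hp.2)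

theorem sideConst_enclosed (h : ∀ᶠ p in 𝓝 v, p ∈ K.boundary → f p = f v) :
    SideConst f v K.enclosed := by
  filter_upwards [K.eventually_exists_preconnected h] with r hr _ _ hs hm
  obtain ⟨D, hD, hd, h1, h2⟩ := hr hs
  exact K.mem_enclosed_of_isPreconnected hD hd h1 h2 hm

theorem sideConst_closedRegion (h : ∀ᶠ p in 𝓝 v, p ∈ K.boundary → f p = f v) :
    SideConst f v K.closedRegion := by
  filter_upwards [K.eventually_exists_preconnected h] with r hr _ _ hs hm
  obtain ⟨D, hD, hd, h1, h2⟩ := hr hs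
  exact K.mem_closedRegion_of_isPreconnected hD hd h1 h2 hm

theorem eventually_line_of_notMem (hv : v ∉ K.boundary) (f : ℝ × ℝ →ₗ[ℝ] ℝ) :
    ∀ᶠ p in 𝓝 v, p ∈ K.boundary → f p = f v := by
  filter_upwards [K.isClosed_boundary.isOpen_compl.mem_nhds hv] with p hp hpb
  exact absurd hpb hp

/-- If a segment in the closed region crosses an edge, then both sides of the edge are enclosed. -/
theorem eventually_mem_enclosed (h : ∀ᶠ p in 𝓝 v, p ∈ K.boundary → f p = f v) {a b : ℝ × ℝ}
    (ha : f a < f v) (hb : f v < f b) (hva : segment ℝ v a ⊆ K.closedRegion)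
    (hvb : segment ℝ v b ⊆ K.closedRegion) :
    ∀ᶠ p in 𝓝 v, f p ≠ f v → p ∈ K.enclosed := by
  have key : ∀ w, f w ≠ f v → segment ℝ v w ⊆ K.closedRegion →
      ∀ᶠ p in 𝓝 v, 0 < (f w - f v) * (f p - f v) → p ∈ K.enclosed := by
    intro w hw hsub
    have h1 := (K.eventually_exists_preconnected h).curry
    have ht : Tendsto (fun t : ℝ => v + t • (w - v)) (𝓝[>] 0) (𝓝 v) :=
      ((by fun_prop : Continuous fun t : ℝ => v + t • (w - v)).tendsto' 0 v
        (by simp)).mono_left nhdsWithin_le_nhds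
    have h01 : ∀ᶠ t : ℝ in 𝓝[>] 0, t ∈ Ioo (0 : ℝ) 1 := Ioo_mem_nhdsGT one_pos
    -- A point of the segment close to `v` is off the line, hence off the boundary, hence enclosed;
    -- the whole side near `v` is connected to it.
    obtain ⟨t, ht1, ht2, ht3⟩ := ((ht.eventually h1).and ((ht.eventually h).and h01)).exists
    have hft : f (v + t • (w - v)) - f v = t * (f w - f v) := by
      rw [map_add, map_smul, map_sub, smul_eq_mul, add_sub_cancel_left]
    have hcl : v + t • (w - v) ∈ K.closedRegion := by
      refine hsub ?_
      rw [segment_eq_image']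
      exact ⟨t, ⟨ht3.1.le, ht3.2.le⟩, rfl⟩
    have hen : v + t • (w - v) ∈ K.enclosed := by
      refine hcl.resolve_left fun hbd => ?_
      have := sub_eq_zero.2 (ht2 hbd)
      rw [hft] at this
      exact (mul_ne_zero ht3.1.ne' (sub_ne_zero.2 hw)) this
    filter_upwards [ht1] with p hp hs
    obtain ⟨D, hD, hd, hD1, hD2⟩ := hp (by
      rw [hft, mul_assoc]
      exact mul_pos ht3.1 hs)
    exact K.mem_enclosed_of_isPreconnected hD hd hD1 hD2 hen
  filter_upwards [key a ha.ne hva, key b hb.ne' hvb] with p h1 h2 hp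
  rcases lt_or_gt_of_ne hp with hlt | hgt
  · exact h1 (mul_pos_of_neg_of_neg (sub_neg.2 ha) (sub_neg.2 hlt))
  · exact h2 (mul_pos (sub_pos.2 hb) (sub_pos.2 hgt))

end SimplePolygon

/-! ### The region of a polygon -/

namespace Polygon

variable (P : Polygon)

/-- The points enclosed by the outer polygon that do not lie in a hole. -/
def innerSet : Set (ℝ × ℝ) := P.outer.enclosed \ ⋃ H ∈ P.holes, H.closedRegion

theorem region_eq : P.region = closure P.innerSet := rfl

theorem isOpen_innerSet : IsOpen P.innerSet :=
  P.outer.isOpen_enclosed.sdiff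
    (P.holes.finite_toSet.isClosed_biUnion fun H _ => H.isClosed_closedRegion)

theorem finite_vertices : P.vertices.Finite :=
  P.outer.finite_range_vert.union
    (P.holes.finite_toSet.biUnion fun H _ => H.finite_range_vert)

theorem vert_outer_mem (i) : P.outer.vert i ∈ P.vertices := Or.inl ⟨i, rfl⟩

theorem vert_hole_mem {H : SimplePolygon} (hH : H ∈ P.holes) (i) : H.vert i ∈ P.vertices :=
  Or.inr (mem_biUnion hH ⟨i, rfl⟩)

theorem mem_innerSet_of_isPreconnected {D : Set (ℝ × ℝ)} (hD : IsPreconnected D)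
    (h1 : ∀ p ∈ D, ∀ w ∈ P.vertices, w.1 ≠ p.1) (h2 : ∀ p ∈ D, ∀ w ∈ P.vertices, w.2 ≠ p.2)
    {p q : ℝ × ℝ} (hp : p ∈ D) (hq : q ∈ D) (h : p ∈ P.innerSet) : q ∈ P.innerSet := by
  refine ⟨P.outer.mem_enclosed_of_isPreconnected hD (fun r hr => ?_) hp hq h.1, fun hqH => h.2 ?_⟩
  · exact P.outer.notMem_boundary (fun i => h1 r hr _ (P.vert_outer_mem i))
      (fun i => h2 r hr _ (P.vert_outer_mem i))
  · obtain ⟨H, hH, hqH⟩ := mem_iUnion₂.1 hqH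
    exact mem_biUnion hH (H.mem_closedRegion_of_isPreconnected hD
      (fun r hr => H.notMem_boundary (fun i => h1 r hr _ (P.vert_hole_mem hH i))
        (fun i => h2 r hr _ (P.vert_hole_mem hH i))) hq hp hqH)

/-- The region is a finite union of rectangles. -/
theorem exists_region_eq_unionOf : ∃ F : Finset Rect, P.region = unionOf F := by
  set X := Prod.fst '' P.vertices
  set Y := Prod.snd '' P.vertices
  have hX : X.Finite := P.finite_vertices.image _
  have hY : Y.Finite := P.finite_vertices.image _
  have hfin : {R : Rect | (R.left ∈ X ∧ R.right ∈ X ∧ R.bottom ∈ Y ∧ R.top ∈ Y) ∧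
      R.toSet ⊆ P.region}.Finite :=
    (Rect.finite_of_coords hX hY).subset fun R hR => hR.1
  refine ⟨hfin.toFinset, Subset.antisymm ?_ ?_⟩
  · refine closure_minimal (((dense_compl_prod_compl hX hY).open_subset_closure_inter
      P.isOpen_innerSet).trans (closure_minimal ?_ (isClosed_unionOf _))) (isClosed_unionOf _)
    rintro p ⟨hp, hpX, hpY⟩
    -- The rectangle is the cell around `p` in the grid of coordinate lines through the vertices. It
    -- is bounded because vertices lie on all sides of `p`, and no boundary enters its open part.
    obtain ⟨⟨i1, h1⟩, ⟨i2, h2⟩, ⟨i3, h3⟩, ⟨i4, h4⟩⟩ := P.outer.exists_vert_bounds hp.1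
    have hmX : ∀ i, (P.outer.vert i).1 ∉ Xᶜ := fun i hi => hi ⟨_, P.vert_outer_mem i, rfl⟩
    have hmY : ∀ i, (P.outer.vert i).2 ∉ Yᶜ := fun i hi => hi ⟨_, P.vert_outer_mem i, rfl⟩
    obtain ⟨l, r, hl, hr, hlr, hlX, hrX⟩ := exists_maximal_Ioo hX.isClosed.isOpen_compl hpX
      ⟨_, h1, hmX i1⟩ ⟨_, h2, hmX i2⟩
    obtain ⟨b, t, hb, ht, hbt, hbY, htY⟩ := exists_maximal_Ioo hY.isClosed.isOpen_compl hpY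
      ⟨_, h3, hmY i3⟩ ⟨_, h4, hmY i4⟩
    let R : Rect := ⟨l, r, b, t, hl.trans hr, hb.trans ht⟩
    have hpR : p ∈ R.openSet := ⟨⟨hl, hr⟩, hb, ht⟩
    refine mem_unionOf.2 ⟨R, hfin.mem_toFinset.2 ⟨⟨not_not.1 hlX, not_not.1 hrX, not_not.1 hbY,
      not_not.1 htY⟩, ?_⟩, R.openSet_subset_toSet hpR⟩
    rw [region_eq, ← R.closure_openSet]
    exact closure_mono fun q hq => P.mem_innerSet_of_isPreconnected R.isPreconnected_openSet
      (fun r hr w hw e => hlr hr.1 ⟨w, hw, e⟩) (fun r hr w hw e => hbt hr.2 ⟨w, hw, e⟩) hpR hq hp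
  · intro p hp
    obtain ⟨R, hR, hpR⟩ := mem_unionOf.1 hp
    exact (hfin.mem_toFinset.1 hR).2 hpR

variable {P} {v : ℝ × ℝ}

theorem sideConst_innerSet {f : ℝ × ℝ →ₗ[ℝ] ℝ} (h : SideConst f v P.outer.enclosed)
    (h' : ∀ H ∈ P.holes, SideConst f v H.closedRegion) : SideConst f v P.innerSet := by
  -- The pair is swapped because holes are removed: the second point lying in a hole must put the
  -- first one there.
  have h'' : ∀ᶠ r in 𝓝 v ×ˢ 𝓝 v, ∀ H ∈ P.holes, (r.2.1 ≠ v.1 ∧ r.2.2 ≠ v.2) →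
      (r.1.1 ≠ v.1 ∧ r.1.2 ≠ v.2) → 0 < (f r.2 - f v) * (f r.1 - f v) →
      r.2 ∈ H.closedRegion → r.1 ∈ H.closedRegion := by
    rw [eventually_all_finset]
    exact fun H hH => tendsto_prod_swap.eventually (h' H hH)
  filter_upwards [h, h''] with r hr hr' h1 h2 hs hm
  refine ⟨hr h1 h2 hs hm.1, fun hq => hm.2 ?_⟩
  obtain ⟨H, hH, hq⟩ := mem_iUnion₂.1 hq
  exact mem_biUnion hH (hr' H hH h2 h1 (by rwa [mul_comm]) hq)

/-- Near a point that is not a vertex, the region is a union of half-planes bounded by an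
axis-parallel line. -/
theorem exists_sideConst (hv : v ∉ P.vertices) :
    ∃ f g, SimplePolygon.IsAxisPair f g ∧ SideConst f v P.innerSet := by
  have hvE : v ∉ range P.outer.vert := fun ⟨i, h⟩ => hv (h ▸ P.vert_outer_mem i)
  have hvH : ∀ H ∈ P.holes, v ∉ range H.vert := fun H hH ⟨i, h⟩ => hv (h ▸ P.vert_hole_mem hH i)
  have hfst : SimplePolygon.IsAxisPair (LinearMap.fst ℝ ℝ ℝ) (LinearMap.snd ℝ ℝ ℝ) :=
    Or.inl ⟨rfl, rfl⟩
  by_cases hex : ∃ H ∈ P.holes, v ∈ H.closedRegion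
  · obtain ⟨H, hH, hvHc⟩ := hex
    -- Two holes meet only in vertices, so no other hole contains `v`.
    have holes : ∀ f, SideConst f v H.closedRegion →
        ∀ H' ∈ P.holes, SideConst f v H'.closedRegion := by
      intro f hf H' hH'
      by_cases he : H' = H
      · rwa [he]
      · refine sideConst_of_notMem H'.isClosed_closedRegion fun hvH' => hvH H hH ?_
        exact ((P.holes_meet H hH H' hH' (Ne.symm he)).2 ⟨hvHc, hvH'⟩).1
    by_cases hbE : v ∈ P.outer.boundary
    · obtain ⟨f, g, hfg, hf, -⟩ := P.outer.exists_line hbE hvE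
      by_cases hbH : v ∈ H.boundary
      · obtain ⟨f', g', hfg', hf', a, b, ha, hb, hva, hvb⟩ := H.exists_line hbH (hvH H hH)
        refine ⟨f', g', hfg', sideConst_innerSet ?_ (holes f' (H.sideConst_closedRegion hf'))⟩
        by_cases hff : f' = f
        · subst hff
          exact P.outer.sideConst_enclosed hf
        · have hgf : g' = f := by
            rcases hfg with ⟨h1, -⟩ | ⟨h1, -⟩ <;> rcases hfg' with ⟨h3, h4⟩ | ⟨h3, h4⟩
            · exact absurd (h3.trans h1.symm) hff
            · exact h4.trans h1.symm
            · exact h4.trans h1.symm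
            · exact absurd (h3.trans h1.symm) hff
          subst hgf
          -- The two edges are perpendicular at `v`. The hole's edge stays in the outer closed
          -- region on both sides of the outer edge, so near `v` everything off that edge is
          -- enclosed and the hole alone determines the set.
          have hsub : H.boundary ⊆ P.outer.closedRegion :=
            subset_union_left.trans (P.holes_contained H hH).subset
          have hall := P.outer.eventually_mem_enclosed hf ha hb (hva.trans hsub) (hvb.trans hsub)
          filter_upwards [tendsto_snd.eventually hall] with r hr _ h2 _ _
          refine hr ?_
          rcases hfg with ⟨rfl, -⟩ | ⟨rfl, -⟩
          · exact h2.1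
          · exact h2.2
      · exact ⟨f, g, hfg, sideConst_innerSet (P.outer.sideConst_enclosed hf)
          (holes f (H.sideConst_closedRegion (H.eventually_line_of_notMem hbH f)))⟩
    · by_cases hbH : v ∈ H.boundary
      · obtain ⟨f, g, hfg, hf, -⟩ := H.exists_line hbH (hvH H hH)
        exact ⟨f, g, hfg, sideConst_innerSet
          (P.outer.sideConst_enclosed (P.outer.eventually_line_of_notMem hbE f))
          (holes f (H.sideConst_closedRegion hf))⟩
      · exact ⟨_, _, hfst, sideConst_innerSet
          (P.outer.sideConst_enclosed (P.outer.eventually_line_of_notMem hbE _))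
          (holes _ (H.sideConst_closedRegion (H.eventually_line_of_notMem hbH _)))⟩
  · push Not at hex
    have holes : ∀ f, ∀ H ∈ P.holes, SideConst f v H.closedRegion :=
      fun f H hH => sideConst_of_notMem H.isClosed_closedRegion (hex H hH)
    by_cases hbE : v ∈ P.outer.boundary
    · obtain ⟨f, g, hfg, hf, -⟩ := P.outer.exists_line hbE hvE
      exact ⟨f, g, hfg, sideConst_innerSet (P.outer.sideConst_enclosed hf) (holes f)⟩
    · exact ⟨_, _, hfst, sideConst_innerSet
        (P.outer.sideConst_enclosed (P.outer.eventually_line_of_notMem hbE _)) (holes _)⟩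

/-- The missing quadrant of a concave corner has a neighbouring full quadrant on the same side of
the line, so constancy on sides would fill the missing one. -/
theorem not_isConcaveAt_closure {f g : ℝ × ℝ →ₗ[ℝ] ℝ} (hfg : SimplePolygon.IsAxisPair f g)
    {A : Set (ℝ × ℝ)} (hA : SideConst f v A) : ¬ IsConcaveAt (closure A) v := by
  rintro ⟨s, t, hs, ht, h⟩
  obtain ⟨U, hU, V, hV, hUV⟩ := mem_prod_iff.1 hA
  obtain ⟨ε, hε, hεUV⟩ := Metric.mem_nhds_iff.1 (inter_mem hU hV)
  obtain ⟨δ, hδ, H⟩ := eventually_nhds_prod_iff_abs.1 h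
  obtain ⟨η, h0, h1, h2⟩ : ∃ η : ℝ, 0 < η ∧ η < ε ∧ η < δ :=
    ⟨min ε δ / 2, by positivity, by linarith [min_le_left ε δ, lt_min hε hδ],
      by linarith [min_le_right ε δ, lt_min hε hδ]⟩
  have hs' : |s| = 1 := by rcases hs with rfl | rfl <;> simp
  have ht' : |t| = 1 := by rcases ht with rfl | rfl <;> simp
  have hss : s * s = 1 := by rcases hs with rfl | rfl <;> simp
  have htt : t * t = 1 := by rcases ht with rfl | rfl <;> simp
  -- The signs `σ`, `τ` name that neighbour: the missing quadrant `(s, t)` with the sign along the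
  -- line reversed.
  obtain ⟨σ, τ, hσ, hτ, hσs, hτt, hneg, hf⟩ : ∃ σ τ : ℝ, |σ| = 1 ∧ |τ| = 1 ∧ σ * σ = 1 ∧ τ * τ = 1 ∧
      (s * σ < 0 ∨ t * τ < 0) ∧ ∀ p : ℝ × ℝ, 0 < σ * (p.1 - v.1) → 0 < τ * (p.2 - v.2) →
        0 < (f p - f v) * (f (v.1 + s * η, v.2 + t * η) - f v) := by
    rcases hfg with ⟨rfl, -⟩ | ⟨rfl, -⟩
    · refine ⟨s, -t, hs', by rwa [abs_neg], hss, by linarith, Or.inr (by linarith),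
        fun p hp _ => ?_⟩
      simp only [LinearMap.fst_apply, add_sub_cancel_left]
      nlinarith [mul_pos hp h0]
    · refine ⟨-s, t, by rwa [abs_neg], ht', by linarith, htt, Or.inl (by linarith),
        fun p _ hp => ?_⟩
      simp only [LinearMap.snd_apply, add_sub_cancel_left]
      nlinarith [mul_pos hp h0]
  have habs : ∀ {c a : ℝ}, |a| = 1 → |c + a * η - c| = η := by
    intro c a ha
    rw [add_sub_cancel_left, abs_mul, ha, one_mul, abs_of_pos h0]
  have hn : (v.1 + σ * η, v.2 + τ * η) ∈ closure A := by
    refine (H _ _ (by rwa [habs hσ]) (by rwa [habs hτ])).2 fun hq => ?_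
    simp only [add_sub_cancel_left] at hq
    rcases hneg with hneg | hneg
    · nlinarith [hq.1]
    · nlinarith [hq.2]
  have hopen : IsOpen (Metric.ball v ε ∩ {p | 0 < σ * (p.1 - v.1) ∧ 0 < τ * (p.2 - v.2)}) :=
    Metric.isOpen_ball.inter
      ((isOpen_lt (f := fun _ : ℝ × ℝ => (0 : ℝ)) (g := fun p => σ * (p.1 - v.1)) (by fun_prop)
        (by fun_prop)).inter
      (isOpen_lt (f := fun _ : ℝ × ℝ => (0 : ℝ)) (g := fun p => τ * (p.2 - v.2)) (by fun_prop)
        (by fun_prop)))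
  have hball : ∀ {a b : ℝ}, |a| = 1 → |b| = 1 → (v.1 + a * η, v.2 + b * η) ∈ Metric.ball v ε := by
    intro a b ha hb
    rw [Metric.mem_ball, Prod.dist_eq, Real.dist_eq, Real.dist_eq]
    exact max_lt (by rwa [habs ha]) (by rwa [habs hb])
  obtain ⟨p, ⟨hpb, hp1, hp2⟩, hpA⟩ := mem_closure_iff.1 hn _ hopen
    ⟨hball hσ hτ, by simp [← mul_assoc, hσs, h0], by simp [← mul_assoc, hτt, h0]⟩
  have hq : (v.1 + s * η, v.2 + t * η) ∈ A := by
    refine hUV (mk_mem_prod (hεUV hpb).1 (hεUV (hball hs' ht')).2)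
      ⟨fun e => ?_, fun e => ?_⟩ ⟨fun e => ?_, fun e => ?_⟩ (hf p hp1 hp2) hpA
    · exact hp1.ne' (mul_eq_zero_of_right _ (sub_eq_zero.2 e))
    · exact hp2.ne' (mul_eq_zero_of_right _ (sub_eq_zero.2 e))
    · have := habs (c := v.1) hs'
      rw [show v.1 + s * η = v.1 from e, sub_self, abs_zero] at this
      exact h0.ne this
    · have := habs (c := v.2) ht'
      rw [show v.2 + t * η = v.2 from e, sub_self, abs_zero] at this
      exact h0.ne this
  refine (H _ _ (by rwa [habs hs']) (by rwa [habs ht'])).1 (subset_closure hq) ?_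
  simp [← mul_assoc, hss, htt, h0]

/-- The strips need rays from every concave point of the region, whereas `rays` starts only at
vertices; this reconciles the two. -/
theorem isConcaveVertex_iff : P.IsConcaveVertex v ↔ IsConcaveAt P.region v := by
  refine ⟨fun h => h.2, fun h => ⟨?_, h⟩⟩
  by_contra hv
  obtain ⟨f, g, hfg, hA⟩ := exists_sideConst hv
  exact not_isConcaveAt_closure hfg hA h

theorem segment_vertical {x w y : ℝ} :
    segment ℝ (x, w) (x, y) = (fun z => (x, z)) '' uIcc w y := by
  rw [← Prod.image_mk_segment_right, segment_eq_uIcc]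

theorem segment_horizontal {y w x : ℝ} :
    segment ℝ (w, y) (x, y) = (fun z => (z, y)) '' uIcc w x := by
  rw [← Prod.image_mk_segment_left, segment_eq_uIcc]

theorem rays_eq (P : Polygon) : P.rays = vrays P.region ∪ hrays P.region := by
  have hh : ∀ x y : ℝ, (x, y) ∈ hrays P.region ↔ ∃ w, IsConcaveAt P.region (w, y) ∧ w ≠ x ∧
      ∀ z ∈ uIcc w x, z ≠ w → (z, y) ∈ interior P.region := by
    intro x y
    simp only [hrays, vrays, isConcaveAt_swap, interior_swap_preimage]
    rfl
  ext ⟨x, y⟩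
  rw [mem_union, hh]
  constructor
  · rintro ⟨⟨a, b⟩, hv, hne, rfl | rfl, hz⟩
    · refine Or.inl ⟨b, isConcaveVertex_iff.1 hv, fun e => hne (Prod.ext rfl e.symm),
        fun z hz1 hzb => hz _ ?_ fun e => hzb (congrArg Prod.snd e)⟩
      dsimp only
      rw [segment_vertical]
      exact mem_image_of_mem _ hz1
    · refine Or.inr ⟨a, isConcaveVertex_iff.1 hv, fun e => hne (Prod.ext e.symm rfl),
        fun z hz1 hzb => hz _ ?_ fun e => hzb (congrArg Prod.fst e)⟩
      dsimp only
      rw [segment_horizontal]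
      exact mem_image_of_mem _ hz1
  · rintro (⟨w, hw, hne, hz⟩ | ⟨w, hw, hne, hz⟩)
    · refine ⟨(x, w), isConcaveVertex_iff.2 hw, fun e => hne (congrArg Prod.snd e).symm,
        Or.inl rfl, ?_⟩
      rw [segment_vertical]
      rintro _ ⟨z, hz1, rfl⟩ hzw
      exact hz z hz1 fun e => hzw (by rw [e])
    · refine ⟨(w, y), isConcaveVertex_iff.2 hw, fun e => hne (congrArg Prod.fst e).symm,
        Or.inr rfl, ?_⟩
      rw [segment_horizontal]
      rintro _ ⟨z, hz1, rfl⟩ hzw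
      exact hz z hz1 fun e => hzw (by rw [e])

end Polygon

end RectCover

end

theorem mainTheorem1 (P : RectCover.Polygon) (α β : ℝ) (hα : 0 ≤ α) (hβ : 0 ≤ β) :
    ∃ C : Finset RectCover.Rect, RectCover.IsOptimalCover P α β C ∧
      (C : Set RectCover.Rect) ⊆ RectCover.rectPowerset (RectCover.baseRects P) := by
  obtain ⟨F, hF⟩ := P.exists_region_eq_unionOf
  exact RectCover.exists_optimal_cover hF P.rays_eq hα hβ
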